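/- A finite graph $\mathcal G=(V,E)$ consists of a finite vertex set $V$ and a set of edges $E\subseteq V\times V$; for $\gamma=(s,t)\in E$ write $s(\gamma)=s$, $t(\gamma)=t$. It is connected if $V\neq\emptyset$ and any two vertices are joined by a finite sequence of consecutively adjacent edges, regardless of their direction. For $n\ge 1$ let $\mathcal G^{\amalg n}$ be the disjoint union of $n$ copies of $\mathcal G$, and write $k(i)$ for the vertex $i\in V$ in the $k$-th copy. The quantum automorphism group $A_{aut}(\mathcal G)$ is the universal unital $C^*$-algebra with generators $(X_{ij})_{i,j\in V}$ and relations $$X_{ij}^*=X_{ij},\quad X_{ij}X_{ik}=\delta_{jk}X_{ij},\quad X_{ji}X_{ki}=\delta_{jk}X_{ji},\quad \sum_{l\in V}X_{il}=1=\sum_{l\in V}X_{li},$$ $$X_{s(\gamma)i}X_{t(\gamma)k}=X_{t(\gamma)k}X_{s(\gamma)i}=0,\quad X_{is(\gamma)}X_{kt(\gamma)}=X_{kt(\gamma)}X_{is(\gamma)}=0\qquad(\gamma\in E,\ (i,k)\notin E),$$ $$X_{s(\gamma)s(\gamma')}X_{t(\gamma)t(\gamma')}=X_{t(\gamma)t(\gamma')}X_{s(\gamma)s(\gamma')}\qquad(\gamma,\gamma'\in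 E),$$ $$\sum_{\gamma'\in E}X_{s(\gamma')s(\gamma)}X_{t(\gamma')t(\gamma)}=1=\sum_{\gamma'\in E}X_{s(\gamma)s(\gamma')}X_{t(\gamma)t(\gamma')}\qquad(\gamma\in E),$$ with coproduct $\Delta(X_{ij})=\sum_kX_{ik}\otimes X_{kj}$. Here, as everywhere below, $\otimes$ is the minimal $C^*$-tensor product. The quantum permutation group $A_{aut}(X_n)$ is the universal unital $C^*$-algebra with generators $(x_{kl})_{1\le k,l\le n}$ and the relations of the first line only, with the same formula for the coproduct. A Woronowicz algebra is a unital $C^*$-algebra $A$ with a $*$-homomorphism $\Delta:A\to A\otimes A$ and a family of unitary matrices $u^\lambda\in M_{d_\lambda}(A)$ with invertible transposes, such that $\Delta(u^\lambda_{ij})=\sum_ku^\lambda_{ik}\otimes u^\lambda_{kj}$ and the entries $u^\lambda_{ij}$ generate a dense subalgebra of $A$. An isomorphism of Woronowicz algebras is a $*$-isomorphism $\Phi$ with $\Delta\circ\Phi=(\Phi\otimes\Phi)\circ\Delta$. The free wreath product $A *_{\rm w} A_{aut}(X_n)$ of a Woronowicz algebra $A$ by $A_{aut}(X_n)$ is the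 quotient of the unital $C^*$-algebra free product $A^{*n}*A_{aut}(X_n)$, with canonical maps $\nu_1,\dots,\nu_n$ from the $n$ copies of $A$, by the closed two-sided ideal generated by the elements $\nu_k(a)x_{ki}-x_{ki}\nu_k(a)$ ($1\le i,k\le n$, $a\in A$), with coproduct $$\Delta(x_{ij})=\sum_{k=1}^nx_{ik}\otimes x_{kj},\qquad \Delta(\nu_i(a))=\sum_{k=1}^n(\nu_i\otimes\nu_k)(\Delta(a))\,(x_{ik}\otimes1).$$ **Theorem.** Let $\mathcal G=(V,E)$ be a finite connected graph and let $n\ge1$. Denote by $u_{ij}$ the generators of $A_{aut}(\mathcal G)$ and by $X_{k(i)l(j)}$ those of $A_{aut}(\mathcal G^{\amalg n})$. Then there is an isomorphism of Woronowicz algebras $$\Phi:A_{aut}(\mathcal G^{\amalg n})\longrightarrow A_{aut}(\mathcal G) *_{\rm w} A_{aut}(X_n),\qquad \Phi(X_{k(i)l(j)})=\nu_k(u_{ij})\,x_{kl}\quad(1\le k,l\le n,\ i,j\in V).$$ -/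

import Mathlib

open scoped TensorProduct

universe u v w

/-- A C*-seminorm on a unital complex `*`-algebra. -/
structure CStarSeminorm (A : Type u) [Ring A] [StarRing A] [Algebra ℂ A] where
  toFun : A → ℝ
  nonneg' : ∀ a, 0 ≤ toFun a
  add_le' : ∀ a b, toFun (a + b) ≤ toFun a + toFun b
  smul' : ∀ (c : ℂ) (a : A), toFun (c • a) = ‖c‖ * toFun a
  mul_le' : ∀ a b, toFun (a * b) ≤ toFun a * toFun b
  star_mul_self' : ∀ a, toFun (star a * a) = toFun a ^ 2

theorem continuous_starAlgHom {B : Type v} {C : Type w} [CStarAlgebra B] [CStarAlgebra C]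
    (f : B →⋆ₐ[ℂ] C) : Continuous f := by
  open scoped CStarAlgebra in exact map_continuous f

namespace CStarSeminorm

variable {A : Type u} [Ring A] [StarRing A] [Algebra ℂ A]

instance : CoeFun (CStarSeminorm A) (fun _ => A → ℝ) := ⟨toFun⟩

variable (p : CStarSeminorm A)

theorem zero' : p 0 = 0 := by simpa using p.smul' 0 0

theorem neg' (a : A) : p (-a) = p a := by simpa using p.smul' (-1) a

theorem star' (a : A) : p (star a) = p a := by
  have key : ∀ a, p a ≤ p (star a) := fun a => by
    have h1 := p.star_mul_self' a
    have h2 := p.mul_le' (star a) a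
    rcases (p.nonneg' a).eq_or_lt with h | h
    · rw [← h]; exact p.nonneg' _
    · nlinarith
  exact le_antisymm (by simpa using key (star a)) (key a)

theorem sub_comm' (a b : A) : p (a - b) = p (b - a) := by
  rw [← p.neg' (a - b), neg_sub]

theorem eq_of_sub (a b : A) (h : p (a - b) = 0) : p a = p b := by
  have h1 := p.add_le' (a - b) b
  have h2 := p.add_le' (b - a) a
  rw [p.sub_comm'] at h2
  simp only [sub_add_cancel, h] at h1 h2
  linarith

/-- The pointwise supremum of a pointwise bounded set of C*-seminorms. -/
noncomputable def sup (S : Set (CStarSeminorm A))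
    (hS : ∀ a, BddAbove ((fun p : CStarSeminorm A => p a) '' S)) : CStarSeminorm A where
  toFun a := sSup ((fun p : CStarSeminorm A => p a) '' S)
  nonneg' a := Real.sSup_nonneg (by rintro _ ⟨p, -, rfl⟩; exact p.nonneg' a)
  add_le' a b := by
    refine Real.sSup_le ?_ (add_nonneg
      (Real.sSup_nonneg (by rintro _ ⟨p, -, rfl⟩; exact p.nonneg' a))
      (Real.sSup_nonneg (by rintro _ ⟨p, -, rfl⟩; exact p.nonneg' b)))
    rintro _ ⟨p, hp, rfl⟩
    exact (p.add_le' a b).trans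
      (add_le_add (le_csSup (hS a) ⟨p, hp, rfl⟩) (le_csSup (hS b) ⟨p, hp, rfl⟩))
  smul' c a := by
    rw [← smul_eq_mul, ← Real.sSup_smul_of_nonneg (norm_nonneg c)]
    congr 1
    ext r
    simp [Set.mem_smul_set, smul']
  mul_le' a b := by
    refine Real.sSup_le ?_ (mul_nonneg
      (Real.sSup_nonneg (by rintro _ ⟨p, -, rfl⟩; exact p.nonneg' a))
      (Real.sSup_nonneg (by rintro _ ⟨p, -, rfl⟩; exact p.nonneg' b)))
    rintro _ ⟨p, hp, rfl⟩
    exact (p.mul_le' a b).trans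
      (mul_le_mul (le_csSup (hS a) ⟨p, hp, rfl⟩) (le_csSup (hS b) ⟨p, hp, rfl⟩) (p.nonneg' b)
        (Real.sSup_nonneg (by rintro _ ⟨p, -, rfl⟩; exact p.nonneg' a)))
  star_mul_self' a := by
    have h0 : 0 ≤ sSup ((fun p : CStarSeminorm A => p a) '' S) :=
      Real.sSup_nonneg (by rintro _ ⟨p, -, rfl⟩; exact p.nonneg' a)
    apply le_antisymm
    · refine Real.sSup_le ?_ (sq_nonneg _)
      rintro _ ⟨p, hp, rfl⟩
      dsimp only
      rw [p.star_mul_self']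
      exact pow_le_pow_left₀ (p.nonneg' a) (le_csSup (hS a) ⟨p, hp, rfl⟩) 2
    · have h1 : sSup ((fun p : CStarSeminorm A => p a) '' S) ≤
          √(sSup ((fun p : CStarSeminorm A => p (star a * a)) '' S)) := by
        refine Real.sSup_le ?_ (Real.sqrt_nonneg _)
        rintro _ ⟨p, hp, rfl⟩
        apply Real.le_sqrt_of_sq_le
        dsimp only
        rw [← p.star_mul_self']
        exact le_csSup (hS (star a * a)) ⟨p, hp, rfl⟩
      calc _ ≤ (√(sSup ((fun p : CStarSeminorm A => p (star a * a)) '' S))) ^ 2 :=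
            pow_le_pow_left₀ h0 h1 2
        _ = _ := Real.sq_sqrt
          (Real.sSup_nonneg (by rintro _ ⟨p, -, rfl⟩; exact p.nonneg' _))

theorem le_sup {S : Set (CStarSeminorm A)} (hS) {p : CStarSeminorm A} (hp : p ∈ S) (a : A) :
    p a ≤ sup S hS a := le_csSup (hS a) ⟨p, hp, rfl⟩

theorem sup_le {S : Set (CStarSeminorm A)} (hS) {a : A} {r : ℝ} (hr : 0 ≤ r)
    (h : ∀ p ∈ S, p a ≤ r) : sup S hS a ≤ r :=
  Real.sSup_le (by rintro _ ⟨p, hp, rfl⟩; exact h p hp) hr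

/-- The `*`-algebra `A`, regarded as a seminormed algebra through `p`. -/
def Semi (_p : CStarSeminorm A) : Type u := A

instance : Ring p.Semi := inferInstanceAs (Ring A)
instance : StarRing p.Semi := inferInstanceAs (StarRing A)
instance : Algebra ℂ p.Semi := inferInstanceAs (Algebra ℂ A)
instance [StarModule ℂ A] : StarModule ℂ p.Semi := inferInstanceAs (StarModule ℂ A)

noncomputable instance : SeminormedRing p.Semi :=
  { (inferInstance : Ring p.Semi),
    AddGroupSeminorm.toSeminormedAddCommGroup (E := p.Semi)
      { toFun := p.toFun, map_zero' := p.zero', add_le' := p.add_le', neg' := p.neg' } with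
    norm_mul_le := p.mul_le' }

noncomputable instance : NormedAlgebra ℂ p.Semi where
  norm_smul_le c a := (p.smul' c a).le

instance : NormedStarGroup p.Semi where
  norm_star_le a := (p.star' a).le

/-- The Hausdorff completion of a `*`-algebra for a C*-seminorm. -/
def Completion : Type u := UniformSpace.Completion p.Semi

noncomputable instance : NormedRing p.Completion :=
  inferInstanceAs (NormedRing (UniformSpace.Completion p.Semi))
instance : CompleteSpace p.Completion :=
  inferInstanceAs (CompleteSpace (UniformSpace.Completion p.Semi))
noncomputable instance : Algebra ℂ p.Completion :=
  inferInstanceAs (Algebra ℂ (UniformSpace.Completion p.Semi))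
noncomputable instance : NormedAlgebra ℂ p.Completion where
  norm_smul_le := norm_smul_le (α := ℂ) (β := UniformSpace.Completion p.Semi)

/-- The canonical ring homomorphism to the completion. -/
noncomputable def coeHom : p.Semi →+* p.Completion :=
  UniformSpace.Completion.coeRingHom (α := p.Semi)

theorem norm_coeHom (a : p.Semi) : ‖p.coeHom a‖ = p a :=
  UniformSpace.Completion.norm_coe (E := p.Semi) a

theorem isometry_coeHom : Isometry p.coeHom := UniformSpace.Completion.coe_isometry

theorem denseRange_coeHom : DenseRange p.coeHom :=
  UniformSpace.Completion.denseRange_coe (α := p.Semi)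

noncomputable instance : Star p.Completion :=
  ⟨UniformSpace.Completion.map (star : p.Semi → p.Semi)⟩

theorem isometry_star_completion : Isometry (star : p.Completion → p.Completion) :=
  (star_isometry (E := p.Semi)).completion_map

theorem coeHom_star (a : p.Semi) : p.coeHom (star a) = star (p.coeHom a) :=
  (UniformSpace.Completion.map_coe (star_isometry (E := p.Semi)).uniformContinuous a).symm

noncomputable instance : StarRing p.Completion where
  star_involutive x := by
    have hs := p.isometry_star_completion.continuous
    refine p.denseRange_coeHom.induction_on x (isClosed_eq (hs.comp hs) continuous_id) fun a => ?_
    rw [← coeHom_star, ← coeHom_star, star_star]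
  star_mul x y := by
    have hs := p.isometry_star_completion.continuous
    refine p.denseRange_coeHom.induction_on₂ (isClosed_eq (by fun_prop) (by fun_prop))
      (fun a b => ?_) x y
    rw [← map_mul, ← coeHom_star, ← coeHom_star, ← coeHom_star, star_mul, map_mul]
  star_add x y := by
    have hs := p.isometry_star_completion.continuous
    refine p.denseRange_coeHom.induction_on₂ (isClosed_eq (by fun_prop) (by fun_prop))
      (fun a b => ?_) x y
    rw [← map_add, ← coeHom_star, ← coeHom_star, ← coeHom_star, star_add, map_add]

theorem coeHom_smul (c : ℂ) (a : p.Semi) : p.coeHom (c • a) = c • p.coeHom a :=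
  UniformSpace.Completion.coe_smul (X := p.Semi) c a

theorem norm_coeHom_sq (a : p.Semi) :
    ‖p.coeHom a‖ * ‖p.coeHom a‖ = ‖p.coeHom (star a * a)‖ := by
  rw [norm_coeHom, norm_coeHom, ← sq]
  exact (p.star_mul_self' a).symm

instance : CStarRing p.Completion where
  norm_mul_self_le x := by
    have hs := p.isometry_star_completion.continuous
    refine p.denseRange_coeHom.induction_on x (isClosed_le (by fun_prop) (by fun_prop)) fun a => ?_
    rw [← coeHom_star, ← map_mul, norm_coeHom_sq]

instance [StarModule ℂ A] : StarModule ℂ p.Completion where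
  star_smul c x := by
    have hs := p.isometry_star_completion.continuous
    refine p.denseRange_coeHom.induction_on x (isClosed_eq (hs.comp (continuous_const_smul c))
      (hs.const_smul (star c))) fun a => ?_
    rw [← coeHom_smul, ← coeHom_star, ← coeHom_star, star_smul, coeHom_smul]

noncomputable instance [StarModule ℂ A] : CStarAlgebra p.Completion where

/-- The canonical `*`-homomorphism from `A` to its completion. -/
noncomputable def toCompletion : A →⋆ₐ[ℂ] p.Completion where
  toFun a := p.coeHom a
  map_one' := map_one p.coeHom
  map_mul' := map_mul p.coeHom
  map_zero' := map_zero p.coeHom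
  map_add' := map_add p.coeHom
  commutes' _ := rfl
  map_star' := p.coeHom_star

theorem norm_toCompletion (a : A) : ‖p.toCompletion a‖ = p a := p.norm_coeHom a

theorem denseRange_toCompletion : DenseRange p.toCompletion := p.denseRange_coeHom

theorem toCompletion_eq {a b : A} (h : p (a - b) = 0) : p.toCompletion a = p.toCompletion b := by
  rw [← sub_eq_zero, ← map_sub, ← norm_eq_zero, norm_toCompletion, h]

theorem completion_hom_ext [StarModule ℂ A] {B : Type v} [CStarAlgebra B] {f g : p.Completion →⋆ₐ[ℂ] B}
    (h : ∀ a, f (p.toCompletion a) = g (p.toCompletion a)) : f = g :=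
  DFunLike.coe_injective <| p.denseRange_toCompletion.equalizer (continuous_starAlgHom f)
    (continuous_starAlgHom g) (funext h)

theorem continuous_semi {B : Type v} [CStarAlgebra B] (f : p.Semi →⋆ₐ[ℂ] B)
    (hf : ∀ a, ‖f a‖ ≤ p a) : Continuous f :=
  AddMonoidHomClass.continuous_of_bound f 1 fun a => (hf a).trans (one_mul (p a)).ge

theorem extension_coeHom {B : Type v} [CStarAlgebra B] (f : p.Semi →⋆ₐ[ℂ] B)
    (hf : ∀ a, ‖f a‖ ≤ p a) (a : p.Semi) :
    UniformSpace.Completion.extensionHom (α := p.Semi) f.toAlgHom.toRingHom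
      (p.continuous_semi f hf) (p.coeHom a) = f a :=
  UniformSpace.Completion.extensionHom_coe (α := p.Semi) f.toAlgHom.toRingHom
    (p.continuous_semi f hf) a

/-- A `*`-homomorphism bounded by `p` extends to the completion. -/
noncomputable def lift {B : Type v} [CStarAlgebra B] (f : A →⋆ₐ[ℂ] B) (hf : ∀ a, ‖f a‖ ≤ p a) :
    p.Completion →⋆ₐ[ℂ] B :=
  let g : p.Semi →⋆ₐ[ℂ] B := f
  let e : p.Completion →+* B :=
    UniformSpace.Completion.extensionHom (α := p.Semi) g.toAlgHom.toRingHom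
      (p.continuous_semi g hf)
  have he : ∀ a, e (p.coeHom a) = g a := p.extension_coeHom g hf
  have hce : Continuous e := UniformSpace.Completion.continuous_extension
  { e with
    commutes' := fun c => (he (algebraMap ℂ p.Semi c)).trans (g.toAlgHom.commutes c)
    map_star' := fun x => by
      have hs := p.isometry_star_completion.continuous
      change e (star x) = star (e x)
      refine p.denseRange_coeHom.induction_on x
        (isClosed_eq (hce.comp hs) hce.star) fun a => ?_
      rw [← coeHom_star, he, he, map_star] }

theorem lift_toCompletion {B : Type v} [CStarAlgebra B] (f : A →⋆ₐ[ℂ] B) (hf : ∀ a, ‖f a‖ ≤ p a)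
    (a : A) : p.lift f hf (p.toCompletion a) = f a := p.extension_coeHom f hf a

/-- The C*-seminorm `a ↦ ‖f a‖` of a `*`-homomorphism to a C*-algebra. -/
def ofHom {B : Type v} [CStarAlgebra B] (f : A →⋆ₐ[ℂ] B) : CStarSeminorm A where
  toFun a := ‖f a‖
  nonneg' a := norm_nonneg _
  add_le' a b := by rw [map_add]; exact norm_add_le _ _
  smul' c a := by rw [map_smul, norm_smul]
  mul_le' a b := by rw [map_mul]; exact norm_mul_le _ _
  star_mul_self' a := by rw [map_mul, map_star, CStarRing.norm_star_mul_self, sq]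

end CStarSeminorm

/-! ### Universal C*-algebras -/

/-- The C*-seminorms on `A` for which the relations `r a b` (meaning `a = b`) hold. -/
def CStarSeminorm.respecting {A : Type u} [Ring A] [StarRing A] [Algebra ℂ A]
    (r : A → A → Prop) : Set (CStarSeminorm A) :=
  {p | ∀ a b, r a b → p (a - b) = 0}

/-- Relations on a `*`-algebra are admissible if the C*-seminorms respecting
them are pointwise bounded. -/
def CStarAdmissible {A : Type u} [Ring A] [StarRing A] [Algebra ℂ A] (r : A → A → Prop) : Prop :=
  ∀ a, BddAbove ((fun p : CStarSeminorm A => p a) '' CStarSeminorm.respecting r)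

section UnivCStar

variable {A : Type u} [Ring A] [StarRing A] [Algebra ℂ A] [StarModule ℂ A]
  {r : A → A → Prop} (hr : CStarAdmissible r)

/-- The universal (enveloping) C*-algebra of the `*`-algebra `A` with relations `r`: the Hausdorff
completion of `A` for the largest C*-seminorm for which the relations hold. -/
def UnivCStar : Type u := (CStarSeminorm.sup (CStarSeminorm.respecting r) hr).Completion

namespace UnivCStar

noncomputable instance : CStarAlgebra (UnivCStar hr) :=
  inferInstanceAs (CStarAlgebra (CStarSeminorm.sup _ hr).Completion)

/-- The canonical map. -/
noncomputable def of : A →⋆ₐ[ℂ] UnivCStar hr := (CStarSeminorm.sup _ hr).toCompletion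

theorem of_rel {a b : A} (h : r a b) : of hr a = of hr b :=
  CStarSeminorm.toCompletion_eq _ <| le_antisymm
    (CStarSeminorm.sup_le hr le_rfl fun _ hp => (hp a b h).le) (CStarSeminorm.nonneg' _ _)

theorem denseRange_of : DenseRange (of hr) := CStarSeminorm.denseRange_toCompletion _

theorem hom_ext {B : Type v} [CStarAlgebra B] {f g : UnivCStar hr →⋆ₐ[ℂ] B}
    (h : ∀ a, f (of hr a) = g (of hr a)) : f = g := CStarSeminorm.completion_hom_ext _ h

/-- The universal property. -/
noncomputable def lift {B : Type v} [CStarAlgebra B] (f : A →⋆ₐ[ℂ] B)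
    (hf : ∀ a b, r a b → f a = f b) : UnivCStar hr →⋆ₐ[ℂ] B :=
  (CStarSeminorm.sup _ hr).lift f fun a =>
    CStarSeminorm.le_sup hr (p := CStarSeminorm.ofHom f)
      (fun a b h => by simp [CStarSeminorm.ofHom, hf a b h]) a

@[simp] theorem lift_of {B : Type v} [CStarAlgebra B] (f : A →⋆ₐ[ℂ] B)
    (hf : ∀ a b, r a b → f a = f b) (a : A) : lift hr f hf (of hr a) = f a :=
  CStarSeminorm.lift_toCompletion _ _ _ _

end UnivCStar

end UnivCStar

/-- Every C*-seminorm on a C*-algebra is dominated by the norm. -/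
theorem CStarSeminorm.le_norm {A : Type u} [CStarAlgebra A] (p : CStarSeminorm A) (a : A) :
    p a ≤ ‖a‖ := by
  rw [← p.norm_toCompletion]
  exact NonUnitalStarAlgHom.norm_apply_le p.toCompletion a

theorem CStarAdmissible.of_cstar {A : Type u} [CStarAlgebra A] (r : A → A → Prop) :
    CStarAdmissible r := fun a => ⟨‖a‖, by rintro _ ⟨p, -, rfl⟩; exact p.le_norm a⟩

/-! ### Free `*`-algebras -/

/-- The free unital complex `*`-algebra on a set `S`: the algebra of the free monoid on two copies
of `S`, standing for the generators and their adjoints. -/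
abbrev FreeStarAlgebra (S : Type u) : Type u := MonoidAlgebra ℂ (FreeMonoid (S ⊕ S))

namespace FreeStarAlgebra

variable {S : Type u}

/-- A generator or the adjoint of a generator. -/
noncomputable def letter (s : S ⊕ S) : FreeStarAlgebra S := MonoidAlgebra.single (FreeMonoid.of s) 1

@[elab_as_elim]
theorem induction {C : FreeStarAlgebra S → Prop} (x : FreeStarAlgebra S)
    (h_c : ∀ c, C (algebraMap ℂ _ c)) (h_l : ∀ s, C (letter s))
    (h_add : ∀ x y, C x → C y → C (x + y)) (h_mul : ∀ x y, C x → C y → C (x * y)) : C x := by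
  have hw : ∀ w : FreeMonoid (S ⊕ S), C (MonoidAlgebra.single w 1) := fun w => by
    induction w using FreeMonoid.inductionOn' with
    | one => simpa using h_c 1
    | of_mul s w ih =>
      have := h_mul _ _ (h_l s) ih
      rwa [letter, MonoidAlgebra.single_mul_single, one_mul] at this
  induction x using MonoidAlgebra.induction_linear with
  | zero => simpa using h_c 0
  | add x y hx hy => exact h_add x y hx hy
  | single w c =>
    have := h_mul _ _ (h_c c) (hw w)
    simpa using this

/-- The reversal of words exchanging generators and adjoints and conjugating the scalars,
as a ring homomorphism to the opposite ring. -/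
noncomputable def starHom : FreeStarAlgebra S →+* (FreeStarAlgebra S)ᵐᵒᵖ :=
  MonoidAlgebra.liftNCRingHom
    ((algebraMap ℂ (FreeStarAlgebra S)ᵐᵒᵖ).comp (starRingEnd ℂ))
    (FreeMonoid.lift fun s => MulOpposite.op (letter s.swap))
    fun c _ => Algebra.commute_algebraMap_left (starRingEnd ℂ c) _

noncomputable instance : Star (FreeStarAlgebra S) := ⟨fun x => (starHom x).unop⟩

theorem star_eq (x : FreeStarAlgebra S) : star x = (starHom x).unop := rfl

theorem star_letter (s : S ⊕ S) : star (letter s) = letter s.swap := by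
  rw [star_eq, starHom, letter, MonoidAlgebra.liftNCRingHom_single]
  simp [← MonoidAlgebra.one_def]

theorem star_algebraMap' (c : ℂ) : star (algebraMap ℂ (FreeStarAlgebra S) c) =
    algebraMap ℂ (FreeStarAlgebra S) (star c) := by
  rw [star_eq, starHom, MonoidAlgebra.coe_algebraMap, Function.comp_apply,
    MonoidAlgebra.liftNCRingHom_single]
  simp [MulOpposite.algebraMap_apply]

theorem star_mul' (x y : FreeStarAlgebra S) : star (x * y) = star y * star x := by
  simp [star_eq]

theorem star_add' (x y : FreeStarAlgebra S) : star (x + y) = star x + star y := by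
  simp [star_eq]

noncomputable instance : StarRing (FreeStarAlgebra S) where
  star_involutive x := by
    induction x using induction with
    | h_c c => rw [star_algebraMap', star_algebraMap', star_star]
    | h_l s => rw [star_letter, star_letter, Sum.swap_swap]
    | h_add x y hx hy => rw [star_add', star_add', hx, hy]
    | h_mul x y hx hy => rw [star_mul', star_mul', hx, hy]
  star_mul := star_mul'
  star_add := star_add'

instance : StarModule ℂ (FreeStarAlgebra S) where
  star_smul c x := by
    rw [Algebra.smul_def, star_mul', star_algebraMap', Algebra.smul_def, Algebra.commutes]

/-- The generator attached to `s`. -/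
noncomputable def gen (s : S) : FreeStarAlgebra S := letter (Sum.inl s)

theorem letter_inr (s : S) : letter (Sum.inr s) = star (gen s) := (star_letter (Sum.inl s)).symm

/-- The `*`-homomorphism determined by the images of the generators. -/
noncomputable def lift {B : Type v} [Ring B] [StarRing B] [Algebra ℂ B] [StarModule ℂ B]
    (f : S → B) : FreeStarAlgebra S →⋆ₐ[ℂ] B :=
  let g : FreeStarAlgebra S →ₐ[ℂ] B := MonoidAlgebra.lift ℂ B (FreeMonoid (S ⊕ S))
    (FreeMonoid.lift (Sum.elim f fun s => star (f s)))
  have hg : ∀ s, g (letter s) = Sum.elim f (fun s => star (f s)) s := fun s =>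
    (MonoidAlgebra.lift_single _ _ _).trans (by simp)
  { g with
    map_star' := fun x => by
      change g (star x) = star (g x)
      induction x using induction with
      | h_c c => rw [star_algebraMap', AlgHom.commutes, AlgHom.commutes, algebraMap_star_comm]
      | h_l s => rw [star_letter, hg, hg]; rcases s with s | s <;> simp
      | h_add x y hx hy => simp [hx, hy]
      | h_mul x y hx hy => simp [hx, hy] }

@[simp] theorem lift_gen {B : Type v} [Ring B] [StarRing B] [Algebra ℂ B] [StarModule ℂ B]
    (f : S → B) (s : S) : lift f (gen s) = f s :=
  (MonoidAlgebra.lift_single _ _ _).trans (by simp)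

theorem hom_ext {B : Type v} [Ring B] [StarRing B] [Algebra ℂ B] {f g : FreeStarAlgebra S →⋆ₐ[ℂ] B}
    (h : ∀ s, f (gen s) = g (gen s)) : f = g := by
  ext x
  induction x using induction with
  | h_c c => exact (f.toAlgHom.commutes c).trans (g.toAlgHom.commutes c).symm
  | h_l s =>
    rcases s with s | s
    · exact h s
    · rw [letter_inr, map_star, map_star, h]
  | h_add x y hx hy => simp [hx, hy]
  | h_mul x y hx hy => simp [hx, hy]

/-- Relations which bound the generators are admissible. -/
theorem admissible {r : FreeStarAlgebra S → FreeStarAlgebra S → Prop}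
    (h : ∀ s, ∃ C : ℝ, ∀ p ∈ CStarSeminorm.respecting r, p (gen s) ≤ C) : CStarAdmissible r := by
  have key : ∀ x : FreeStarAlgebra S,
      ∃ C : ℝ, 0 ≤ C ∧ ∀ p ∈ CStarSeminorm.respecting r, p x ≤ C := fun x => by
    induction x using induction with
    | h_c c =>
      refine ⟨‖c‖, norm_nonneg _, fun p _ => ?_⟩
      have h1 : p (1 : FreeStarAlgebra S) ≤ 1 := by
        have := p.star_mul_self' 1
        rw [star_one, one_mul] at this
        nlinarith [p.nonneg' (1 : FreeStarAlgebra S)]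
      rw [Algebra.algebraMap_eq_smul_one, p.smul']
      exact mul_le_of_le_one_right (norm_nonneg _) h1
    | h_l s =>
      rcases s with s | s
      · obtain ⟨C, hC⟩ := h s
        exact ⟨max C 0, le_max_right _ _, fun p hp => (hC p hp).trans (le_max_left _ _)⟩
      · obtain ⟨C, hC⟩ := h s
        refine ⟨max C 0, le_max_right _ _, fun p hp => ?_⟩
        rw [letter_inr, p.star']
        exact (hC p hp).trans (le_max_left _ _)
    | h_add x y hx hy =>
      obtain ⟨C, hC0, hC⟩ := hx
      obtain ⟨D, hD0, hD⟩ := hy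
      exact ⟨C + D, add_nonneg hC0 hD0, fun p hp =>
        (p.add_le' x y).trans (add_le_add (hC p hp) (hD p hp))⟩
    | h_mul x y hx hy =>
      obtain ⟨C, hC0, hC⟩ := hx
      obtain ⟨D, hD0, hD⟩ := hy
      exact ⟨C * D, mul_nonneg hC0 hD0, fun p hp =>
        (p.mul_le' x y).trans (mul_le_mul (hC p hp) (hD p hp) (p.nonneg' y) hC0)⟩
  intro x
  obtain ⟨C, -, hC⟩ := key x
  exact ⟨C, by rintro _ ⟨p, hp, rfl⟩; exact hC p hp⟩

end FreeStarAlgebra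

/-! ### The minimal tensor product -/

/-- The bounded operators on a pre-Hilbert space. -/
abbrev BddOp (E : Type u) [NormedAddCommGroup E] [InnerProductSpace ℂ E] : Type u := E →L[ℂ] E

theorem norm_sq_eq_inner {E : Type u} [NormedAddCommGroup E] [InnerProductSpace ℂ E] (ξ : E) :
    ‖ξ‖ ^ 2 = ‖inner ℂ ξ ξ‖ := by
  rw [inner_self_eq_norm_sq_to_K]; simp

/-- The operator `S ⊗ T`. -/
noncomputable def BddOp.tensor {H K : Type u} [NormedAddCommGroup H] [InnerProductSpace ℂ H]
    [NormedAddCommGroup K] [InnerProductSpace ℂ K] (S : BddOp H) (T : BddOp K) :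
    BddOp (H ⊗[ℂ] K) := TensorProduct.mapL S T

section MinTensor

variable (A B : Type u) [CStarAlgebra A] [CStarAlgebra B]

/-- The representation `π ⊗ ρ` of the algebraic tensor product `A ⊗ B` on the algebraic
(pre-Hilbert) tensor product `H ⊗ K`, by bounded operators. -/
noncomputable def tensorRep {A B : Type u} [CStarAlgebra A] [CStarAlgebra B]
    {H K : Type u} [NormedAddCommGroup H] [InnerProductSpace ℂ H] [CompleteSpace H]
    [NormedAddCommGroup K] [InnerProductSpace ℂ K] [CompleteSpace K]
    (π : A →⋆ₐ[ℂ] BddOp H) (ρ : B →⋆ₐ[ℂ] BddOp K) :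
    A ⊗[ℂ] B →ₐ[ℂ] BddOp (H ⊗[ℂ] K) :=
  Algebra.TensorProduct.algHomOfLinearMapTensorProduct
    (TensorProduct.lift (LinearMap.mk₂ ℂ (fun a b => BddOp.tensor (π a) (ρ b))
      (fun a a' b => by rw [map_add]; exact TensorProduct.mapL_add_left _ _ _)
      (fun c a b => by rw [map_smul]; exact TensorProduct.mapL_smul_left _ _ _)
      (fun a b b' => by rw [map_add]; exact TensorProduct.mapL_add_right _ _ _)
      (fun c a b => by rw [map_smul]; exact TensorProduct.mapL_smul_right _ _ _)))
    (fun a a' b b' => by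
      simp only [TensorProduct.lift.tmul, LinearMap.mk₂_apply, map_mul]
      exact TensorProduct.mapL_mul _ _ _ _)
    (by
      simp only [TensorProduct.lift.tmul, LinearMap.mk₂_apply, map_one]
      exact TensorProduct.mapL_id_id)

section

variable {A B : Type u} [CStarAlgebra A] [CStarAlgebra B]
    {H K : Type u} [NormedAddCommGroup H] [InnerProductSpace ℂ H] [CompleteSpace H]
    [NormedAddCommGroup K] [InnerProductSpace ℂ K] [CompleteSpace K]
    (π : A →⋆ₐ[ℂ] BddOp H) (ρ : B →⋆ₐ[ℂ] BddOp K)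

theorem tensorRep_tmul (a : A) (b : B) :
    tensorRep π ρ (a ⊗ₜ b) = BddOp.tensor (π a) (ρ b) := rfl

theorem tensorRep_inner (x : A ⊗[ℂ] B) (ξ η : H ⊗[ℂ] K) :
    inner ℂ (tensorRep π ρ x ξ) η = inner ℂ ξ (tensorRep π ρ (star x) η) := by
  induction x with
  | zero => simp
  | add x y hx hy => simp [inner_add_left, inner_add_right, hx, hy]
  | tmul a b =>
    rw [TensorProduct.star_tmul, tensorRep_tmul, tensorRep_tmul]
    induction ξ with
    | zero => simp
    | add x y hx hy => simp only [map_add, inner_add_left, hx, hy]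
    | tmul h k =>
      induction η with
      | zero => simp
      | add x y hx hy => simp only [map_add, inner_add_right, hx, hy]
      | tmul h' k' =>
        rw [BddOp.tensor, BddOp.tensor, TensorProduct.mapL_tmul, TensorProduct.mapL_tmul,
          TensorProduct.inner_tmul,
          TensorProduct.inner_tmul, map_star, map_star, ContinuousLinearMap.star_eq_adjoint,
          ContinuousLinearMap.star_eq_adjoint, ContinuousLinearMap.adjoint_inner_right,
          ContinuousLinearMap.adjoint_inner_right]

theorem tensorRep_norm_sq_le (x : A ⊗[ℂ] B) :
    ‖tensorRep π ρ x‖ ^ 2 ≤ ‖tensorRep π ρ (star x * x)‖ := by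
  have h : ‖tensorRep π ρ x‖ ≤ √‖tensorRep π ρ (star x * x)‖ := by
    refine ContinuousLinearMap.opNorm_le_bound _ (Real.sqrt_nonneg _) fun ξ => ?_
    conv_rhs => rw [← Real.sqrt_sq (norm_nonneg ξ), ← Real.sqrt_mul (norm_nonneg _)]
    apply Real.le_sqrt_of_sq_le
    calc ‖tensorRep π ρ x ξ‖ ^ 2 = ‖inner ℂ (tensorRep π ρ x ξ) (tensorRep π ρ x ξ)‖ := by
          exact norm_sq_eq_inner _
      _ = ‖inner ℂ ξ (tensorRep π ρ (star x * x) ξ)‖ := by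
          rw [tensorRep_inner, map_mul]; rfl
      _ ≤ ‖ξ‖ * (‖tensorRep π ρ (star x * x)‖ * ‖ξ‖) :=
          (norm_inner_le_norm _ _).trans
            (mul_le_mul_of_nonneg_left (ContinuousLinearMap.le_opNorm _ _) (norm_nonneg _))
      _ = _ := by ring
  calc _ ≤ _ := pow_le_pow_left₀ (norm_nonneg _) h 2
    _ = _ := Real.sq_sqrt (norm_nonneg _)

/-- The C*-seminorm `x ↦ ‖(π ⊗ ρ)(x)‖` on the algebraic tensor product. -/
noncomputable def tensorSeminorm : CStarSeminorm (A ⊗[ℂ] B) where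
  toFun x := ‖tensorRep π ρ x‖
  nonneg' _ := norm_nonneg _
  add_le' _ _ := by rw [map_add]; exact norm_add_le _ _
  smul' _ _ := by rw [map_smul, norm_smul]
  mul_le' _ _ := by rw [map_mul]; exact norm_mul_le _ _
  star_mul_self' x := by
    have h1 := tensorRep_norm_sq_le π ρ x
    have h2 := tensorRep_norm_sq_le π ρ (star x)
    have h3 : ∀ y, ‖tensorRep π ρ (star y * y)‖ ≤ ‖tensorRep π ρ (star y)‖ * ‖tensorRep π ρ y‖ :=
      fun y => by rw [map_mul]; exact norm_mul_le _ _
    have h4 := h3 x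
    have h5 := h3 (star x)
    rw [star_star] at h2 h5
    have a0 := norm_nonneg (tensorRep π ρ x)
    have b0 := norm_nonneg (tensorRep π ρ (star x))
    have hab : ‖tensorRep π ρ (star x)‖ ≤ ‖tensorRep π ρ x‖ := by
      by_contra! hlt
      nlinarith
    nlinarith

end

/-- The seminorms `x ↦ ‖(π ⊗ ρ)(x)‖` for all representations `π` of `A` and `ρ` of `B` on Hilbert
spaces. -/
def spatialSeminorms : Set (CStarSeminorm (A ⊗[ℂ] B)) :=
  {p | ∃ (H K : Type u) (_ : NormedAddCommGroup H) (_ : InnerProductSpace ℂ H)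
    (_ : CompleteSpace H) (_ : NormedAddCommGroup K) (_ : InnerProductSpace ℂ K)
    (_ : CompleteSpace K) (π : A →⋆ₐ[ℂ] BddOp H) (ρ : B →⋆ₐ[ℂ] BddOp K),
    p = tensorSeminorm π ρ}

theorem spatialSeminorms_bdd (x : A ⊗[ℂ] B) :
    BddAbove ((fun p : CStarSeminorm (A ⊗[ℂ] B) => p x) '' spatialSeminorms A B) := by
  have key : ∃ C : ℝ, ∀ p ∈ spatialSeminorms A B, p x ≤ C := by
    induction x with
    | zero => exact ⟨0, fun p _ => p.zero'.le⟩
    | add x y hx hy =>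
      obtain ⟨C, hC⟩ := hx
      obtain ⟨D, hD⟩ := hy
      exact ⟨C + D, fun p hp => (p.add_le' x y).trans (add_le_add (hC p hp) (hD p hp))⟩
    | tmul a b =>
      refine ⟨‖a‖ * ‖b‖, ?_⟩
      rintro _ ⟨H, K, _, _, _, _, _, _, π, ρ, rfl⟩
      exact (TensorProduct.norm_mapL_le (π a) (ρ b)).trans
        (mul_le_mul (NonUnitalStarAlgHom.norm_apply_le π a)
          (NonUnitalStarAlgHom.norm_apply_le ρ b) (norm_nonneg _) (norm_nonneg _))
  obtain ⟨C, hC⟩ := key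
  exact ⟨C, by rintro _ ⟨p, hp, rfl⟩; exact hC p hp⟩

/-- The minimal (spatial) tensor product of C*-algebras: the completion of the algebraic tensor
product for the norm `‖x‖ = sup ‖(π ⊗ ρ)(x)‖`, over all pairs of representations. Hilbert spaces in
the universe of `A` and `B` suffice: the GNS spaces of all states, and their direct sums over all
states, live there. -/
def MinTensor : Type u :=
  (CStarSeminorm.sup (spatialSeminorms A B) (spatialSeminorms_bdd A B)).Completion

noncomputable instance : CStarAlgebra (MinTensor A B) :=
  inferInstanceAs (CStarAlgebra (CStarSeminorm.sup (spatialSeminorms A B) _).Completion)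

end MinTensor

namespace MinTensor

variable {A B C D : Type u} [CStarAlgebra A] [CStarAlgebra B] [CStarAlgebra C] [CStarAlgebra D]

/-- The canonical map from the algebraic tensor product. -/
noncomputable def of : A ⊗[ℂ] B →⋆ₐ[ℂ] MinTensor A B :=
  (CStarSeminorm.sup _ (spatialSeminorms_bdd A B)).toCompletion

/-- Elementary tensors. -/
noncomputable def tmul (a : A) (b : B) : MinTensor A B := of (a ⊗ₜ b)

scoped infixl:70 " ⊗ₘ " => MinTensor.tmul

theorem tmul_mul_tmul (a a' : A) (b b' : B) : (a ⊗ₘ b) * (a' ⊗ₘ b') = (a * a') ⊗ₘ (b * b') := by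
  simp [tmul, ← map_mul]

theorem star_tmul (a : A) (b : B) : star (a ⊗ₘ b) = star a ⊗ₘ star b := by
  simp [tmul, ← map_star]

theorem one_tmul_one : (1 : A) ⊗ₘ (1 : B) = 1 := by
  simp [tmul, ← Algebra.TensorProduct.one_def]

theorem sum_tmul {ι : Type*} (s : Finset ι) (f : ι → A) (b : B) :
    (∑ i ∈ s, f i) ⊗ₘ b = ∑ i ∈ s, f i ⊗ₘ b := by
  simp [tmul, TensorProduct.sum_tmul]

theorem tmul_sum {ι : Type*} (s : Finset ι) (f : ι → B) (a : A) :
    a ⊗ₘ (∑ i ∈ s, f i) = ∑ i ∈ s, a ⊗ₘ f i := by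
  simp [tmul, TensorProduct.tmul_sum]

@[simp] theorem zero_tmul (b : B) : (0 : A) ⊗ₘ b = 0 := by simp [tmul]

@[simp] theorem tmul_zero (a : A) : a ⊗ₘ (0 : B) = 0 := by simp [tmul]

theorem denseRange_of : DenseRange (of : A ⊗[ℂ] B → MinTensor A B) :=
  CStarSeminorm.denseRange_toCompletion _

/-- An element commuting with all elementary tensors, after applying `f`, commutes with all. -/
theorem commute_of_tmul {E : Type v} [CStarAlgebra E] (f : MinTensor A B →⋆ₐ[ℂ] E) (e : E)
    (h : ∀ a b, Commute (f (a ⊗ₘ b)) e) (x : MinTensor A B) : Commute (f x) e := by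
  have hf := continuous_starAlgHom f
  refine denseRange_of.induction_on x
    (isClosed_eq (hf.mul continuous_const) (continuous_const.mul hf)) fun y => ?_
  change Commute (f (of y)) e
  induction y with
  | zero => simp
  | add x y hx hy => rw [map_add, map_add]; exact hx.add_left hy
  | tmul a b => exact h a b

/-- The tensor product of `*`-homomorphisms, on the algebraic tensor product. -/
noncomputable def algMap (f : A →⋆ₐ[ℂ] C) (g : B →⋆ₐ[ℂ] D) : A ⊗[ℂ] B →⋆ₐ[ℂ] C ⊗[ℂ] D :=
  { Algebra.TensorProduct.map f.toAlgHom g.toAlgHom with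
    map_star' := fun x => by
      change Algebra.TensorProduct.map f.toAlgHom g.toAlgHom (star x) =
        star (Algebra.TensorProduct.map f.toAlgHom g.toAlgHom x)
      induction x with
      | zero => simp
      | add x y hx hy => simp only [star_add, map_add, hx, hy]
      | tmul a b =>
        rw [TensorProduct.star_tmul, Algebra.TensorProduct.map_tmul,
          Algebra.TensorProduct.map_tmul, TensorProduct.star_tmul]
        exact congrArg₂ _ (map_star f a) (map_star g b) }

theorem algMap_tmul (f : A →⋆ₐ[ℂ] C) (g : B →⋆ₐ[ℂ] D) (a : A) (b : B) :
    algMap f g (a ⊗ₜ b) = f a ⊗ₜ g b := rfl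

theorem norm_algMap_le (f : A →⋆ₐ[ℂ] C) (g : B →⋆ₐ[ℂ] D) (x : A ⊗[ℂ] B) :
    ‖(of.comp (algMap f g)) x‖ ≤
      CStarSeminorm.sup _ (spatialSeminorms_bdd A B) x := by
  refine (CStarSeminorm.norm_toCompletion _ (algMap f g x)).le.trans
    (CStarSeminorm.sup_le _ (CStarSeminorm.nonneg' _ _) ?_)
  rintro _ ⟨H, K, _, _, _, _, _, _, π, ρ, rfl⟩
  refine le_trans (le_of_eq ?_) (CStarSeminorm.le_sup (spatialSeminorms_bdd A B)
    ⟨H, K, _, _, _, _, _, _, π.comp f, ρ.comp g, rfl⟩ x)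
  change ‖tensorRep π ρ (algMap f g x)‖ = ‖tensorRep (π.comp f) (ρ.comp g) x‖
  congr 1
  induction x with
  | zero => simp
  | add x y hx hy => simp only [map_add, hx, hy]
  | tmul a b => rfl

/-- The tensor product of `*`-homomorphisms. -/
noncomputable def map (f : A →⋆ₐ[ℂ] C) (g : B →⋆ₐ[ℂ] D) : MinTensor A B →⋆ₐ[ℂ] MinTensor C D :=
  (CStarSeminorm.sup _ (spatialSeminorms_bdd A B)).lift (of.comp (algMap f g))
    (norm_algMap_le f g)

@[simp] theorem map_tmul (f : A →⋆ₐ[ℂ] C) (g : B →⋆ₐ[ℂ] D) (a : A) (b : B) :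
    map f g (a ⊗ₘ b) = f a ⊗ₘ g b :=
  CStarSeminorm.lift_toCompletion _ (of.comp (algMap f g)) (norm_algMap_le f g) (a ⊗ₜ b)

end MinTensor

open scoped MinTensor

/-! ### Woronowicz algebras -/

/-- `u` is a unitary corepresentation for the coproduct `Δ`, with invertible transpose. -/
structure IsUnitaryCorep {A : Type u} [CStarAlgebra A] (Δ : A →⋆ₐ[ℂ] MinTensor A A)
    {ι : Type v} [Fintype ι] [DecidableEq ι] (u : Matrix ι ι A) : Prop where
  unitary : u ∈ unitary (Matrix ι ι A)
  comul : ∀ i j, Δ (u i j) = ∑ k, u i k ⊗ₘ u k j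
  transpose : IsUnit u.transpose

/-- A Woronowicz algebra (compact quantum group): a unital C*-algebra `A` with a `*`-homomorphism
`Δ : A → A ⊗ A` (minimal tensor product) and a family of unitary matrices `u l` over `A` with
`Δ (u i j) = ∑ k, u i k ⊗ u k j` and with invertible transposes, whose entries generate a dense
subalgebra. -/
structure WoronowiczAlgebra : Type (u + 1) where
  carrier : Type u
  [cstar : CStarAlgebra carrier]
  comul : carrier →⋆ₐ[ℂ] MinTensor carrier carrier
  exists_family : ∃ (Λ : Type u) (d : Λ → ℕ) (u : ∀ l, Matrix (Fin (d l)) (Fin (d l)) carrier),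
    (∀ l, IsUnitaryCorep comul (u l)) ∧
    Dense (Algebra.adjoin ℂ {a | ∃ l i j, u l i j = a} : Set carrier)

namespace WoronowiczAlgebra

instance : CoeSort WoronowiczAlgebra.{u} (Type u) := ⟨carrier⟩

instance (A : WoronowiczAlgebra.{u}) : CStarAlgebra A := A.cstar

/-- An isomorphism of Woronowicz algebras: a `*`-isomorphism compatible with the coproducts. -/
structure Iso (A B : WoronowiczAlgebra.{u}) extends A.carrier ≃⋆ₐ[ℂ] B.carrier where
  map_comul : ∀ a, B.comul (toStarAlgEquiv a) =
    MinTensor.map (toStarAlgEquiv : A.carrier →⋆ₐ[ℂ] B.carrier)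
      (toStarAlgEquiv : A.carrier →⋆ₐ[ℂ] B.carrier) (A.comul a)

end WoronowiczAlgebra

/-- The matrix coefficients of all unitary corepresentations with invertible transpose. -/
def corepCoefficients {A : Type u} [CStarAlgebra A] (Δ : A →⋆ₐ[ℂ] MinTensor A A) : Set A :=
  {a | ∃ (d : ℕ) (u : Matrix (Fin d) (Fin d) A), IsUnitaryCorep Δ u ∧ ∃ i j, u i j = a}

theorem exists_family_of_dense {A : Type u} [CStarAlgebra A] {Δ : A →⋆ₐ[ℂ] MinTensor A A}
    (h : Dense (Algebra.adjoin ℂ (corepCoefficients Δ) : Set A)) :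
    ∃ (Λ : Type u) (d : Λ → ℕ) (u : ∀ l, Matrix (Fin (d l)) (Fin (d l)) A),
      (∀ l, IsUnitaryCorep Δ (u l)) ∧
      Dense (Algebra.adjoin ℂ {a | ∃ l i j, u l i j = a} : Set A) := by
  refine ⟨Σ d : ℕ, {u : Matrix (Fin d) (Fin d) A // IsUnitaryCorep Δ u}, fun l => l.1,
    fun l => l.2.1, fun l => l.2.2, h.mono (Algebra.adjoin_mono ?_)⟩
  rintro _ ⟨d, u, hu, i, j, rfl⟩
  exact ⟨⟨d, u, hu⟩, i, j, rfl⟩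

theorem IsUnitaryCorep.mem_coefficients {A : Type u} [CStarAlgebra A]
    {Δ : A →⋆ₐ[ℂ] MinTensor A A} {ι : Type v} [Fintype ι] [DecidableEq ι] {u : Matrix ι ι A}
    (hu : IsUnitaryCorep Δ u) (i j : ι) : u i j ∈ corepCoefficients Δ := by
  let e := Fintype.equivFin ι
  refine ⟨Fintype.card ι, Matrix.reindex e e u, ⟨?_, fun i j => ?_, ?_⟩, e i, e j, by simp⟩
  · rw [Unitary.mem_iff]
    obtain ⟨h1, h2⟩ := Unitary.mem_iff.1 hu.unitary
    simp only [Matrix.star_eq_conjTranspose, Matrix.reindex_apply, Matrix.conjTranspose_submatrix,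
      Matrix.submatrix_mul_equiv] at h1 h2 ⊢
    rw [h1, h2]
    simp
  · simp only [Matrix.reindex_apply, Matrix.submatrix_apply, hu.comul]
    exact Fintype.sum_equiv e _ _ (by simp)
  · have := hu.transpose.map (Matrix.reindexRingEquiv A e)
    rwa [Matrix.transpose_reindex]

/-! ### The quantum automorphism group of a finite graph -/

section Aut

variable {V : Type u} [Fintype V]

open Classical in
/-- The set of edges. -/
noncomputable def Digraph.edges (G : Digraph V) : Finset (V × V) :=
  Finset.univ.filter fun e => G.Adj e.1 e.2

theorem Digraph.mem_edges (G : Digraph V) (e : V × V) : e ∈ G.edges ↔ G.Adj e.1 e.2 := by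
  simp [Digraph.edges]

/-- The generator `X i j` of the free `*`-algebra on `V × V`. -/
noncomputable def autGen (i j : V) : FreeStarAlgebra (V × V) := FreeStarAlgebra.gen (i, j)

local notation "X" => autGen

open Classical in
/-- The defining relations of the quantum automorphism group of a finite graph. -/
inductive AutRel (G : Digraph V) : FreeStarAlgebra (V × V) → FreeStarAlgebra (V × V) → Prop
  | star_gen (i j) : AutRel G (star (X i j)) (X i j)
  | row_mul (i j k) : AutRel G (X i j * X i k) (if j = k then X i j else 0)
  | col_mul (i j k) : AutRel G (X j i * X k i) (if j = k then X j i else 0)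
  | row_sum (i) : AutRel G (∑ l, X i l) 1
  | col_sum (i) : AutRel G (∑ l, X l i) 1
  | edge_row {s t i k} (_ : G.Adj s t) (_ : ¬ G.Adj i k) : AutRel G (X s i * X t k) 0
  | edge_row' {s t i k} (_ : G.Adj s t) (_ : ¬ G.Adj i k) : AutRel G (X t k * X s i) 0
  | edge_col {s t i k} (_ : G.Adj s t) (_ : ¬ G.Adj i k) : AutRel G (X i s * X k t) 0
  | edge_col' {s t i k} (_ : G.Adj s t) (_ : ¬ G.Adj i k) : AutRel G (X k t * X i s) 0
  | edge_comm {s t s' t'} (_ : G.Adj s t) (_ : G.Adj s' t') :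
      AutRel G (X s s' * X t t') (X t t' * X s s')
  | edge_sum {s t} (_ : G.Adj s t) : AutRel G (∑ e ∈ G.edges, X e.1 s * X e.2 t) 1
  | edge_sum' {s t} (_ : G.Adj s t) : AutRel G (∑ e ∈ G.edges, X s e.1 * X t e.2) 1

open Classical in
/-- A matrix in a `*`-algebra satisfying the defining relations of the quantum automorphism
group. -/
structure IsQuantumAut (G : Digraph V) {B : Type v} [Ring B] [StarRing B] (x : V → V → B) :
    Prop where
  star_gen (i j) : star (x i j) = x i j
  row_mul (i j k) : x i j * x i k = if j = k then x i j else 0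
  col_mul (i j k) : x j i * x k i = if j = k then x j i else 0
  row_sum (i) : ∑ l, x i l = 1
  col_sum (i) : ∑ l, x l i = 1
  edge_row {s t i k} (_ : G.Adj s t) (_ : ¬ G.Adj i k) : x s i * x t k = 0
  edge_row' {s t i k} (_ : G.Adj s t) (_ : ¬ G.Adj i k) : x t k * x s i = 0
  edge_col {s t i k} (_ : G.Adj s t) (_ : ¬ G.Adj i k) : x i s * x k t = 0
  edge_col' {s t i k} (_ : G.Adj s t) (_ : ¬ G.Adj i k) : x k t * x i s = 0
  edge_comm {s t s' t'} (_ : G.Adj s t) (_ : G.Adj s' t') : x s s' * x t t' = x t t' * x s s'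
  edge_sum {s t} (_ : G.Adj s t) : ∑ e ∈ G.edges, x e.1 s * x e.2 t = 1
  edge_sum' {s t} (_ : G.Adj s t) : ∑ e ∈ G.edges, x s e.1 * x t e.2 = 1

theorem isQuantumAut_of_hom (G : Digraph V) {B : Type v} [Ring B] [StarRing B] [Algebra ℂ B]
    (f : FreeStarAlgebra (V × V) →⋆ₐ[ℂ] B) (hf : ∀ a b, AutRel G a b → f a = f b) :
    IsQuantumAut G fun i j => f (X i j) where
  star_gen i j := by rw [← map_star]; exact hf _ _ (.star_gen i j)
  row_mul i j k := by
    rw [← map_mul, hf _ _ (.row_mul i j k)]; split_ifs <;> simp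
  col_mul i j k := by
    rw [← map_mul, hf _ _ (.col_mul i j k)]; split_ifs <;> simp
  row_sum i := by rw [← map_sum, hf _ _ (.row_sum i), map_one]
  col_sum i := by rw [← map_sum, hf _ _ (.col_sum i), map_one]
  edge_row h h' := by rw [← map_mul, hf _ _ (.edge_row h h'), map_zero]
  edge_row' h h' := by rw [← map_mul, hf _ _ (.edge_row' h h'), map_zero]
  edge_col h h' := by rw [← map_mul, hf _ _ (.edge_col h h'), map_zero]
  edge_col' h h' := by rw [← map_mul, hf _ _ (.edge_col' h h'), map_zero]
  edge_comm h h' := by rw [← map_mul, ← map_mul, hf _ _ (.edge_comm h h')]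
  edge_sum h := by
    simp only [← map_mul]; rw [← map_sum, hf _ _ (.edge_sum h), map_one]
  edge_sum' h := by
    simp only [← map_mul]; rw [← map_sum, hf _ _ (.edge_sum' h), map_one]

theorem IsQuantumAut.lift_rel {G : Digraph V} {B : Type v} [Ring B] [StarRing B] [Algebra ℂ B]
    [StarModule ℂ B] {x : V → V → B} (hx : IsQuantumAut G x) {a b : FreeStarAlgebra (V × V)}
    (h : AutRel G a b) : FreeStarAlgebra.lift (fun e => x e.1 e.2) a =
      FreeStarAlgebra.lift (fun e => x e.1 e.2) b := by
  cases h with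
  | star_gen i j => rw [map_star]; simp [autGen, hx.star_gen]
  | row_mul i j k => split_ifs with h <;> simp [autGen, hx.row_mul, h]
  | col_mul i j k => split_ifs with h <;> simp [autGen, hx.col_mul, h]
  | row_sum i => simp [autGen, hx.row_sum]
  | col_sum i => simp [autGen, hx.col_sum]
  | edge_row h h' => simp [autGen, hx.edge_row h h']
  | edge_row' h h' => simp [autGen, hx.edge_row' h h']
  | edge_col h h' => simp [autGen, hx.edge_col h h']
  | edge_col' h h' => simp [autGen, hx.edge_col' h h']
  | edge_comm h h' => simp [autGen, hx.edge_comm h h']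
  | edge_sum h => simp [autGen, hx.edge_sum h]
  | edge_sum' h => simp [autGen, hx.edge_sum' h]

theorem autRel_admissible (G : Digraph V) : CStarAdmissible (AutRel G) := by
  refine FreeStarAlgebra.admissible fun ⟨i, j⟩ => ⟨1, fun p hp => ?_⟩
  have h1 := isQuantumAut_of_hom G p.toCompletion fun a b h => p.toCompletion_eq (hp a b h)
  change p (X i j) ≤ 1
  rw [← p.norm_toCompletion]
  have h2 : ‖p.toCompletion (X i j)‖ * ‖p.toCompletion (X i j)‖ = ‖p.toCompletion (X i j)‖ := by
    rw [← CStarRing.norm_star_mul_self, h1.star_gen, h1.row_mul, if_pos rfl]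
  nlinarith [norm_nonneg (p.toCompletion (X i j))]

/-- The C*-algebra of the quantum automorphism group of a finite graph: the universal C*-algebra
with generators `X i j` and the relations `AutRel`. -/
abbrev AutAlgebra (G : Digraph V) : Type u := UnivCStar (autRel_admissible G)

namespace AutAlgebra

variable (G : Digraph V)

/-- The generators. -/
noncomputable def gen (i j : V) : AutAlgebra G := UnivCStar.of _ (X i j)

theorem isQuantumAut_gen : IsQuantumAut G (gen G) :=
  isQuantumAut_of_hom G (UnivCStar.of (autRel_admissible G)) fun _ _ h => UnivCStar.of_rel _ h

/-- The universal property. -/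
noncomputable def lift {G : Digraph V} {B : Type v} [CStarAlgebra B] (x : V → V → B)
    (hx : IsQuantumAut G x) : AutAlgebra G →⋆ₐ[ℂ] B :=
  UnivCStar.lift _ (FreeStarAlgebra.lift fun e => x e.1 e.2) fun _ _ h => hx.lift_rel h

@[simp] theorem lift_gen {G : Digraph V} {B : Type v} [CStarAlgebra B] (x : V → V → B)
    (hx : IsQuantumAut G x) (i j : V) : lift x hx (gen G i j) = x i j := by
  simp [lift, gen, autGen]

end AutAlgebra

theorem sum_tmul_mul_sum_tmul {B C : Type v} [CStarAlgebra B] [CStarAlgebra C]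
    (f f' : V → B) (g g' : V → C) : (∑ a, f a ⊗ₘ g a) * (∑ b, f' b ⊗ₘ g' b) =
      ∑ a, ∑ b, (f a * f' b) ⊗ₘ (g a * g' b) := by
  simp only [Finset.sum_mul, Finset.mul_sum, MinTensor.tmul_mul_tmul]
  exact Finset.sum_comm

/-- The matrix `∑ k, x i k ⊗ x k j` satisfies the relations if `x` does. -/
theorem IsQuantumAut.comul {G : Digraph V} {B : Type v} [CStarAlgebra B] {x : V → V → B}
    (hx : IsQuantumAut G x) : IsQuantumAut G fun i j => ∑ k, x i k ⊗ₘ x k j where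
  star_gen i j := by simp [MinTensor.star_tmul, hx.star_gen]
  row_mul i j k := by
    classical
    rw [sum_tmul_mul_sum_tmul]
    simp only [hx.row_mul]
    have : ∀ a b, (if a = b then x i a else 0) ⊗ₘ (x a j * x b k) =
        if a = b then x i a ⊗ₘ (x a j * x a k) else 0 := by
      intro a b; split_ifs with h <;> simp [h]
    simp only [this, Finset.sum_ite_eq, Finset.mem_univ, if_true, hx.row_mul]
    split_ifs <;> simp
  col_mul i j k := by
    classical
    rw [sum_tmul_mul_sum_tmul]
    simp only [hx.col_mul]
    have : ∀ a b, (x j a * x k b) ⊗ₘ (if a = b then x a i else 0) =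
        if a = b then (x j a * x k a) ⊗ₘ x a i else 0 := by
      intro a b; split_ifs with h <;> simp [h]
    simp only [this, Finset.sum_ite_eq, Finset.mem_univ, if_true, hx.col_mul]
    split_ifs <;> simp
  row_sum i := by
    rw [Finset.sum_comm]
    simp only [← MinTensor.tmul_sum, hx.row_sum, ← MinTensor.sum_tmul, MinTensor.one_tmul_one]
  col_sum i := by
    rw [Finset.sum_comm]
    simp only [← MinTensor.sum_tmul, hx.col_sum, ← MinTensor.tmul_sum, MinTensor.one_tmul_one]
  edge_row {s t i k} h h' := by
    rw [sum_tmul_mul_sum_tmul]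
    refine Finset.sum_eq_zero fun a _ => Finset.sum_eq_zero fun b _ => ?_
    by_cases hab : G.Adj a b
    · rw [hx.edge_row hab h', MinTensor.tmul_zero]
    · rw [hx.edge_row h hab, MinTensor.zero_tmul]
  edge_row' {s t i k} h h' := by
    rw [sum_tmul_mul_sum_tmul]
    refine Finset.sum_eq_zero fun b _ => Finset.sum_eq_zero fun a _ => ?_
    by_cases hab : G.Adj a b
    · rw [hx.edge_row' hab h', MinTensor.tmul_zero]
    · rw [hx.edge_row' h hab, MinTensor.zero_tmul]
  edge_col {s t i k} h h' := by
    rw [sum_tmul_mul_sum_tmul]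
    refine Finset.sum_eq_zero fun a _ => Finset.sum_eq_zero fun b _ => ?_
    by_cases hab : G.Adj a b
    · rw [hx.edge_col hab h', MinTensor.zero_tmul]
    · rw [hx.edge_col h hab, MinTensor.tmul_zero]
  edge_col' {s t i k} h h' := by
    rw [sum_tmul_mul_sum_tmul]
    refine Finset.sum_eq_zero fun b _ => Finset.sum_eq_zero fun a _ => ?_
    by_cases hab : G.Adj a b
    · rw [hx.edge_col' hab h', MinTensor.zero_tmul]
    · rw [hx.edge_col' h hab, MinTensor.tmul_zero]
  edge_comm {s t s' t'} h h' := by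
    rw [sum_tmul_mul_sum_tmul, sum_tmul_mul_sum_tmul, Finset.sum_comm]
    refine Finset.sum_congr rfl fun b _ => Finset.sum_congr rfl fun a _ => ?_
    by_cases hab : G.Adj a b
    · rw [hx.edge_comm h hab, hx.edge_comm hab h']
    · rw [hx.edge_row h hab, hx.edge_row' h hab, MinTensor.zero_tmul, MinTensor.zero_tmul]
  edge_sum {s t} h := by
    simp only [sum_tmul_mul_sum_tmul]
    rw [Finset.sum_comm]
    simp only [Finset.sum_comm (s := G.edges), ← MinTensor.sum_tmul]
    rw [← Finset.sum_product', Finset.univ_product_univ,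
      ← Finset.sum_subset (Finset.subset_univ G.edges) fun e _ he => by
        rw [G.mem_edges] at he
        rw [hx.edge_col h he, MinTensor.tmul_zero]]
    rw [Finset.sum_congr rfl fun e he => by rw [hx.edge_sum ((G.mem_edges e).1 he)],
      ← MinTensor.tmul_sum, hx.edge_sum h, MinTensor.one_tmul_one]
  edge_sum' {s t} h := by
    simp only [sum_tmul_mul_sum_tmul]
    rw [Finset.sum_comm]
    simp only [Finset.sum_comm (s := G.edges), ← MinTensor.tmul_sum]
    rw [← Finset.sum_product', Finset.univ_product_univ,
      ← Finset.sum_subset (Finset.subset_univ G.edges) fun e _ he => by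
        rw [G.mem_edges] at he
        rw [hx.edge_row h he, MinTensor.zero_tmul]]
    rw [Finset.sum_congr rfl fun e he => by rw [hx.edge_sum' ((G.mem_edges e).1 he)],
      ← MinTensor.sum_tmul, hx.edge_sum' h, MinTensor.one_tmul_one]

theorem IsQuantumAut.unitary [DecidableEq V] {G : Digraph V} {B : Type v} [Ring B] [StarRing B] {x : V → V → B}
    (hx : IsQuantumAut G x) : (Matrix.of x) ∈ unitary (Matrix V V B) := by
  rw [Unitary.mem_iff]
  constructor <;> ext i j <;> rw [Matrix.mul_apply, Matrix.one_apply] <;>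
    simp only [Matrix.star_apply, Matrix.of_apply, hx.star_gen, hx.row_mul, hx.col_mul]
  · split_ifs with h
    · exact hx.col_sum i
    · simp
  · split_ifs with h
    · exact hx.row_sum i
    · simp

theorem IsQuantumAut.transpose [DecidableEq V] {G : Digraph V} {B : Type v} [Ring B] [StarRing B] {x : V → V → B}
    (hx : IsQuantumAut G x) : IsUnit (Matrix.of x).transpose := by
  refine ⟨⟨(Matrix.of x).transpose, Matrix.of x, ?_, ?_⟩, rfl⟩ <;> ext i j <;>
    rw [Matrix.mul_apply, Matrix.one_apply] <;>
    simp only [Matrix.transpose_apply, Matrix.of_apply, hx.row_mul, hx.col_mul]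
  · split_ifs with h
    · exact hx.col_sum i
    · simp
  · split_ifs with h
    · exact hx.row_sum i
    · simp

/-- Induction principle: a closed subalgebra containing the images of the generators and their
adjoints contains the image of the universal C*-algebra. -/
theorem UnivCStar.mem_of_gen {S : Type u} {r : FreeStarAlgebra S → FreeStarAlgebra S → Prop}
    (hr : CStarAdmissible r) {C : Type v} [CStarAlgebra C] (f : UnivCStar hr →⋆ₐ[ℂ] C)
    (T : Subalgebra ℂ C) (hT : IsClosed (T : Set C))
    (h : ∀ s, f (UnivCStar.of hr (FreeStarAlgebra.gen s)) ∈ T ∧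
      f (UnivCStar.of hr (star (FreeStarAlgebra.gen s))) ∈ T) (a : UnivCStar hr) : f a ∈ T := by
  refine (UnivCStar.denseRange_of hr).induction_on (p := fun a => f a ∈ T) a
    (hT.preimage (continuous_starAlgHom f)) fun x => ?_
  induction x using FreeStarAlgebra.induction with
  | h_c c =>
    have : f (UnivCStar.of hr (algebraMap ℂ _ c)) = algebraMap ℂ C c := by
      rw [AlgHomClass.commutes, AlgHomClass.commutes]
    rw [this]
    exact T.algebraMap_mem c
  | h_l s =>
    rcases s with s | s
    · exact (h s).1
    · rw [FreeStarAlgebra.letter_inr]; exact (h s).2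
  | h_add x y hx hy => rw [map_add, map_add]; exact T.add_mem hx hy
  | h_mul x y hx hy => rw [map_mul, map_mul]; exact T.mul_mem hx hy

namespace AutAlgebra

variable (G : Digraph V)

/-- The coproduct `X i j ↦ ∑ k, X i k ⊗ X k j`. -/
noncomputable def comul : AutAlgebra G →⋆ₐ[ℂ] MinTensor (AutAlgebra G) (AutAlgebra G) :=
  lift (fun i j => ∑ k, gen G i k ⊗ₘ gen G k j) (isQuantumAut_gen G).comul

theorem comul_gen (i j : V) : comul G (gen G i j) = ∑ k, gen G i k ⊗ₘ gen G k j :=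
  lift_gen _ _ i j

theorem isUnitaryCorep [DecidableEq V] : IsUnitaryCorep (comul G) (Matrix.of (gen G)) where
  unitary := (isQuantumAut_gen G).unitary
  comul := comul_gen G
  transpose := (isQuantumAut_gen G).transpose

end AutAlgebra

/-- The quantum automorphism group of a finite graph. -/
noncomputable def quantumAut (G : Digraph V) : WoronowiczAlgebra.{u} where
  carrier := AutAlgebra G
  comul := AutAlgebra.comul G
  exists_family := exists_family_of_dense <| by
    classical
    intro a
    have hm : ∀ i j, AutAlgebra.gen G i j ∈
        (Algebra.adjoin ℂ (corepCoefficients (AutAlgebra.comul G))).topologicalClosure :=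
      fun i j => Subalgebra.le_topologicalClosure _
        (Algebra.subset_adjoin ((AutAlgebra.isUnitaryCorep G).mem_coefficients i j))
    exact UnivCStar.mem_of_gen _ (StarAlgHom.id ℂ (AutAlgebra G)) _
      (Subalgebra.isClosed_topologicalClosure _) (fun ⟨i, j⟩ => ⟨hm i j, by
        rw [map_star, map_star]
        change star (AutAlgebra.gen G i j) ∈ _
        rw [(AutAlgebra.isQuantumAut_gen G).star_gen]
        exact hm i j⟩) a

end Aut

/-- The C*-algebra of the quantum permutation group on `n` letters: for the graph on `n` vertices
without edges, only the relations `(x i j)* = x i j`, `x i j * x i k = δ x i j`,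
`x j i * x k i = δ x j i` and `∑ l, x i l = 1 = ∑ l, x l i` remain. -/
abbrev PermAlgebra (n : ℕ) : Type := AutAlgebra (⊥ : Digraph (Fin n))

/-! ### Free products and free wreath products -/

section FreeProd

/-- A map satisfying the axioms of a unital `*`-homomorphism, bundled. -/
def StarAlgHom.ofAxioms {A : Type u} {C : Type v} [CStarAlgebra A] [CStarAlgebra C] (f : A → C)
    (h_one : f 1 = 1) (h_mul : ∀ a b, f (a * b) = f a * f b) (h_add : ∀ a b, f (a + b) = f a + f b)
    (h_smul : ∀ (c : ℂ) a, f (c • a) = c • f a) (h_star : ∀ a, f (star a) = star (f a)) :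
    A →⋆ₐ[ℂ] C where
  toFun := f
  map_one' := h_one
  map_mul' := h_mul
  map_zero' := by simpa using h_smul 0 0
  map_add' := h_add
  commutes' c := by rw [Algebra.algebraMap_eq_smul_one, h_smul, h_one,
    Algebra.algebraMap_eq_smul_one]
  map_star' := h_star

variable (n : ℕ) (A : Type u) (B : Type v) [CStarAlgebra A] [CStarAlgebra B]

local notation "F" => FreeStarAlgebra ((Fin n × A) ⊕ B)

variable {n A B} in
/-- The generator for `a` in the `k`-th copy of `A`. -/
noncomputable def genLeft (k : Fin n) (a : A) : F := FreeStarAlgebra.gen (Sum.inl (k, a))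

variable {n A B} in
/-- The generator for `b` in `B`. -/
noncomputable def genRight (b : B) : F := FreeStarAlgebra.gen (Sum.inr b)

local notation "ν" => genLeft (n := n) (A := A) (B := B)
local notation "κ" => genRight (n := n) (A := A) (B := B)

/-- The relations making the maps from the `n` copies of `A` and from `B` unital
`*`-homomorphisms. -/
inductive FreeProdRel : F → F → Prop
  | left_one (k) : FreeProdRel (ν k 1) 1
  | left_mul (k a b) : FreeProdRel (ν k (a * b)) (ν k a * ν k b)
  | left_add (k a b) : FreeProdRel (ν k (a + b)) (ν k a + ν k b)
  | left_smul (k) (c : ℂ) (a) : FreeProdRel (ν k (c • a)) (c • ν k a)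
  | left_star (k a) : FreeProdRel (ν k (star a)) (star (ν k a))
  | right_one : FreeProdRel (κ 1) 1
  | right_mul (a b) : FreeProdRel (κ (a * b)) (κ a * κ b)
  | right_add (a b) : FreeProdRel (κ (a + b)) (κ a + κ b)
  | right_smul (c : ℂ) (a) : FreeProdRel (κ (c • a)) (c • κ a)
  | right_star (a) : FreeProdRel (κ (star a)) (star (κ a))

variable {n A B}

/-- The `*`-homomorphism on the `k`-th copy of `A` induced by `f`. -/
noncomputable def leftHom {C : Type w} [CStarAlgebra C] (f : F →⋆ₐ[ℂ] C)
    (hf : ∀ x y, FreeProdRel n A B x y → f x = f y) (k : Fin n) : A →⋆ₐ[ℂ] C :=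
  StarAlgHom.ofAxioms (fun a => f (ν k a)) ((hf _ _ (.left_one k)).trans (map_one f))
    (fun a b => (hf _ _ (.left_mul k a b)).trans (map_mul f _ _))
    (fun a b => (hf _ _ (.left_add k a b)).trans (map_add f _ _))
    (fun c a => (hf _ _ (.left_smul k c a)).trans (map_smul f _ _))
    (fun a => (hf _ _ (.left_star k a)).trans (map_star f _))

/-- The `*`-homomorphism on `B` induced by `f`. -/
noncomputable def rightHom {C : Type w} [CStarAlgebra C] (f : F →⋆ₐ[ℂ] C)
    (hf : ∀ x y, FreeProdRel n A B x y → f x = f y) : B →⋆ₐ[ℂ] C :=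
  StarAlgHom.ofAxioms (fun a => f (κ a)) ((hf _ _ .right_one).trans (map_one f))
    (fun a b => (hf _ _ (.right_mul a b)).trans (map_mul f _ _))
    (fun a b => (hf _ _ (.right_add a b)).trans (map_add f _ _))
    (fun c a => (hf _ _ (.right_smul c a)).trans (map_smul f _ _))
    (fun a => (hf _ _ (.right_star a)).trans (map_star f _))

variable (n A B)

theorem freeProdRel_admissible : CStarAdmissible (FreeProdRel n A B) := by
  refine FreeStarAlgebra.admissible fun s => ?_
  have hp : ∀ p ∈ CStarSeminorm.respecting (FreeProdRel n A B), ∀ x y, FreeProdRel n A B x y →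
      p.toCompletion x = p.toCompletion y := fun p hp x y h => p.toCompletion_eq (hp x y h)
  rcases s with ⟨k, a⟩ | b
  · refine ⟨‖a‖, fun p h => ?_⟩
    rw [← p.norm_toCompletion]
    exact NonUnitalStarAlgHom.norm_apply_le (leftHom p.toCompletion (hp p h) k) a
  · refine ⟨‖b‖, fun p h => ?_⟩
    rw [← p.norm_toCompletion]
    exact NonUnitalStarAlgHom.norm_apply_le (rightHom p.toCompletion (hp p h)) b

/-- The free product (coproduct of unital C*-algebras) of `n` copies of `A` and one copy of `B`. -/
abbrev FreeProd : Type (max u v) := UnivCStar (freeProdRel_admissible n A B)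

namespace FreeProd

/-- The canonical map from the `k`-th copy of `A`. -/
noncomputable def inl (k : Fin n) : A →⋆ₐ[ℂ] FreeProd n A B :=
  leftHom (UnivCStar.of (freeProdRel_admissible n A B)) (fun _ _ h => UnivCStar.of_rel _ h) k

/-- The canonical map from `B`. -/
noncomputable def inr : B →⋆ₐ[ℂ] FreeProd n A B :=
  rightHom (UnivCStar.of (freeProdRel_admissible n A B)) (fun _ _ h => UnivCStar.of_rel _ h)

variable {n A B}

/-- The universal property of the free product. -/
noncomputable def lift {C : Type w} [CStarAlgebra C] (f : Fin n → A →⋆ₐ[ℂ] C) (g : B →⋆ₐ[ℂ] C) :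
    FreeProd n A B →⋆ₐ[ℂ] C :=
  UnivCStar.lift _ (FreeStarAlgebra.lift (Sum.elim (fun s => f s.1 s.2) g)) fun x y h => by
    have hl : ∀ k a, FreeStarAlgebra.lift (Sum.elim (fun s => f s.1 s.2) g) (ν k a) = f k a :=
      fun k a => FreeStarAlgebra.lift_gen _ _
    have hr : ∀ b, FreeStarAlgebra.lift (Sum.elim (fun s => f s.1 s.2) g) (κ b) = g b :=
      fun b => FreeStarAlgebra.lift_gen _ _
    cases h with
    | left_one k => rw [hl, map_one, map_one]
    | left_mul k a b => rw [map_mul, hl, hl, hl, map_mul]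
    | left_add k a b => rw [map_add, hl, hl, hl, map_add]
    | left_smul k c a => rw [map_smul, hl, hl, map_smul]
    | left_star k a => rw [map_star, hl, hl, map_star]
    | right_one => rw [hr, map_one, map_one]
    | right_mul a b => rw [map_mul, hr, hr, hr, map_mul]
    | right_add a b => rw [map_add, hr, hr, hr, map_add]
    | right_smul c a => rw [map_smul, hr, hr, map_smul]
    | right_star a => rw [map_star, hr, hr, map_star]

@[simp] theorem lift_inl {C : Type w} [CStarAlgebra C] (f : Fin n → A →⋆ₐ[ℂ] C) (g : B →⋆ₐ[ℂ] C)
    (k : Fin n) (a : A) : lift f g (inl n A B k a) = f k a :=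
  (UnivCStar.lift_of _ _ _ _).trans (FreeStarAlgebra.lift_gen _ _)

@[simp] theorem lift_inr {C : Type w} [CStarAlgebra C] (f : Fin n → A →⋆ₐ[ℂ] C) (g : B →⋆ₐ[ℂ] C)
    (b : B) : lift f g (inr n A B b) = g b :=
  (UnivCStar.lift_of _ _ _ _).trans (FreeStarAlgebra.lift_gen _ _)

end FreeProd

end FreeProd

/-- The `*`-homomorphism `a ↦ ∑ k, T k a * q k`, for `*`-homomorphisms `T k` and a partition of
unity by projections `q k` commuting with the range of `T k`. -/
noncomputable def blockHom {A : Type u} {C : Type v} [CStarAlgebra A] [CStarAlgebra C] {n : ℕ}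
    (T : Fin n → A →⋆ₐ[ℂ] C) (q : Fin n → C) (hq : ∀ k, star (q k) = q k)
    (hqq : ∀ k l, q k * q l = if k = l then q k else 0) (hs : ∑ k, q k = 1)
    (hc : ∀ k a, Commute (T k a) (q k)) : A →⋆ₐ[ℂ] C :=
  StarAlgHom.ofAxioms (fun a => ∑ k, T k a * q k) (by simp [hs])
    (fun a b => by
      rw [Finset.sum_mul_sum]
      refine Finset.sum_congr rfl fun k _ => ?_
      have : ∀ l, T k a * q k * (T l b * q l) = if k = l then T k (a * b) * q k else 0 := by
        intro l
        rw [(hc l b).eq, mul_assoc, ← mul_assoc (q k), hqq]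
        split_ifs with h
        · subst h
          rw [← (hc k b).eq, map_mul, mul_assoc]
        · simp
      simp [this])
    (fun a b => by simp [add_mul, Finset.sum_add_distrib])
    (fun c a => by simp [Finset.smul_sum])
    (fun a => by
      rw [star_sum]
      refine Finset.sum_congr rfl fun k _ => ?_
      rw [star_mul, hq, map_star, ← map_star, (hc k (star a)).eq])

theorem commute_block {E : Type v} [Ring E] {n : ℕ} (T p z : Fin n → E)
    (hpz : ∀ l r, p l * z r = if l = r then z l else 0)
    (hzp : ∀ r l, z r * p l = if l = r then z l else 0)
    (hTp : ∀ l, Commute (T l) (p l)) (hTz : ∀ l, Commute (T l) (z l)) :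
    Commute (∑ l, T l * p l) (∑ r, z r) := by
  have h1 : ∀ l r, T l * p l * z r = if l = r then T l * z l else 0 := fun l r => by
    rw [mul_assoc, hpz]; split_ifs <;> simp
  have h2 : ∀ r l, z r * (T l * p l) = if l = r then T l * z l else 0 := fun r l => by
    rw [(hTp l).eq, ← mul_assoc, hzp]
    split_ifs
    · exact (hTz l).eq.symm
    · simp
  rw [Commute, SemiconjBy, Finset.sum_mul_sum, Finset.sum_mul_sum]
  simp [h1, h2]

section Wreath

variable (A : Type u) [CStarAlgebra A] (n : ℕ)

/-- The relations `ν k a * x k i = x k i * ν k a` in the free product of `n` copies of `A` and the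
quantum permutation group. -/
inductive WreathRel : FreeProd n A (PermAlgebra n) → FreeProd n A (PermAlgebra n) → Prop
  | comm (k i : Fin n) (a : A) : WreathRel
      (FreeProd.inl n A _ k a * FreeProd.inr n A _ (AutAlgebra.gen ⊥ k i))
      (FreeProd.inr n A _ (AutAlgebra.gen ⊥ k i) * FreeProd.inl n A _ k a)

/-- The C*-algebra of the free wreath product: the quotient C*-algebra of the free product of `n`
copies of `A` and the quantum permutation group by the closed two-sided ideal generated by the
elements `ν k a * x k i - x k i * ν k a`. The quotient is presented as the separated completion for
the largest C*-seminorm vanishing on these elements, which is the quotient norm. -/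
abbrev WreathAlgebra : Type u := UnivCStar (CStarAdmissible.of_cstar (WreathRel A n))

namespace WreathAlgebra

variable {A n}

/-- The canonical map `ν k` from the `k`-th copy of `A`. -/
noncomputable def ν (k : Fin n) : A →⋆ₐ[ℂ] WreathAlgebra A n :=
  (UnivCStar.of (CStarAdmissible.of_cstar (WreathRel A n))).comp (FreeProd.inl n A _ k)

variable (A) in
/-- The images of the generators `x k l` of the quantum permutation group. -/
noncomputable def x (k l : Fin n) : WreathAlgebra A n :=
  UnivCStar.of (CStarAdmissible.of_cstar (WreathRel A n))
    (FreeProd.inr n A _ (AutAlgebra.gen ⊥ k l))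

theorem isQuantumAut_x : IsQuantumAut (⊥ : Digraph (Fin n)) (x A (n := n)) := by
  exact isQuantumAut_of_hom ⊥ ((UnivCStar.of (CStarAdmissible.of_cstar (WreathRel A n))).comp
    ((FreeProd.inr n A _).comp (UnivCStar.of (autRel_admissible ⊥)))) fun a b h =>
      congrArg (fun y => UnivCStar.of (CStarAdmissible.of_cstar (WreathRel A n))
        (FreeProd.inr n A _ y)) (UnivCStar.of_rel (autRel_admissible ⊥) h)

theorem commute_ν_x (k l : Fin n) (a : A) : Commute (ν k a) (x A k l) := by
  have := UnivCStar.of_rel (CStarAdmissible.of_cstar (WreathRel A n)) (.comm k l a)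
  rwa [map_mul, map_mul] at this

/-- The universal property of the free wreath product. -/
noncomputable def lift {C : Type w} [CStarAlgebra C] (f : Fin n → A →⋆ₐ[ℂ] C) (y : Fin n → Fin n → C)
    (hy : IsQuantumAut (⊥ : Digraph (Fin n)) y) (hc : ∀ k l a, Commute (f k a) (y k l)) :
    WreathAlgebra A n →⋆ₐ[ℂ] C :=
  UnivCStar.lift _ (FreeProd.lift f (AutAlgebra.lift y hy)) fun _ _ h => by
    cases h with
    | comm k i a => simpa using (hc k i a).eq

@[simp] theorem lift_ν {C : Type w} [CStarAlgebra C] (f : Fin n → A →⋆ₐ[ℂ] C)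
    (y : Fin n → Fin n → C) (hy) (hc) (k : Fin n) (a : A) : lift f y hy hc (ν k a) = f k a :=
  (UnivCStar.lift_of _ _ _ _).trans (FreeProd.lift_inl _ _ _ _)

@[simp] theorem lift_x {C : Type w} [CStarAlgebra C] (f : Fin n → A →⋆ₐ[ℂ] C)
    (y : Fin n → Fin n → C) (hy) (hc) (k l : Fin n) : lift f y hy hc (x A k l) = y k l :=
  (UnivCStar.lift_of _ _ _ _).trans <| (FreeProd.lift_inr _ _ _).trans (AutAlgebra.lift_gen _ _ _ _)

/-- A closed subalgebra containing all `ν k a` and `x k l` is everything. -/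
theorem mem_of_gen (T : Subalgebra ℂ (WreathAlgebra A n))
    (hT : IsClosed (T : Set (WreathAlgebra A n)))
    (hν : ∀ k a, ν k a ∈ T) (hx : ∀ k l, x A k l ∈ T) (a : WreathAlgebra A n) : a ∈ T := by
  let π := UnivCStar.of (CStarAdmissible.of_cstar (WreathRel A n))
  have hx' : ∀ b, π (FreeProd.inr n A _ b) ∈ T := by
    refine UnivCStar.mem_of_gen (autRel_admissible (⊥ : Digraph (Fin n)))
      (π.comp (FreeProd.inr n A (PermAlgebra n))) T hT fun ⟨i, j⟩ => ⟨hx i j, ?_⟩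
    rw [map_star, map_star]
    exact ((isQuantumAut_x (A := A)).star_gen i j).symm ▸ hx i j
  refine (UnivCStar.denseRange_of (CStarAdmissible.of_cstar (WreathRel A n))).induction_on
    (p := fun a => a ∈ T) a hT fun b => ?_
  refine UnivCStar.mem_of_gen (freeProdRel_admissible n A _) π T hT (fun s => ?_) b
  rcases s with ⟨k, a⟩ | b
  · refine ⟨hν k a, ?_⟩
    rw [map_star, map_star]
    have := hν k (star a)
    rwa [map_star] at this
  · refine ⟨hx' b, ?_⟩
    rw [map_star, map_star]
    have := hx' (star b)
    rwa [map_star, map_star] at this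

variable (Δ : A →⋆ₐ[ℂ] MinTensor A A)

local notation "H" => WreathAlgebra A n

theorem commute_map_ν (i k : Fin n) (y : MinTensor A A) (l m : Fin n) :
    Commute (MinTensor.map (ν i) (ν k) y) (x A i l ⊗ₘ x A k m) :=
  MinTensor.commute_of_tmul _ _ (fun a b => by
    rw [MinTensor.map_tmul, Commute, SemiconjBy, MinTensor.tmul_mul_tmul,
      MinTensor.tmul_mul_tmul, (commute_ν_x i l a).eq, (commute_ν_x k m b).eq]) y

theorem commute_map_ν' (i k : Fin n) (y : MinTensor A A) (l : Fin n) :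
    Commute (MinTensor.map (ν i) (ν k) y) (x A i l ⊗ₘ (1 : H)) :=
  MinTensor.commute_of_tmul _ _ (fun a b => by
    rw [MinTensor.map_tmul, Commute, SemiconjBy, MinTensor.tmul_mul_tmul,
      MinTensor.tmul_mul_tmul, (commute_ν_x i l a).eq, one_mul, mul_one]) y

/-- The map `a ↦ ∑ k, (ν i ⊗ ν k) (Δ a) * (x i k ⊗ 1)`. -/
noncomputable def comulν (i : Fin n) : A →⋆ₐ[ℂ] MinTensor H H :=
  blockHom (fun k => (MinTensor.map (ν i) (ν k)).comp Δ) (fun k => x A i k ⊗ₘ 1)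
    (fun k => by rw [MinTensor.star_tmul, isQuantumAut_x.star_gen, star_one])
    (fun k l => by
      rw [MinTensor.tmul_mul_tmul, isQuantumAut_x.row_mul, mul_one]
      split_ifs <;> simp_all)
    (by rw [← MinTensor.sum_tmul, isQuantumAut_x.row_sum, MinTensor.one_tmul_one])
    (fun k a => commute_map_ν' i k (Δ a) k)

theorem comulν_apply (i : Fin n) (a : A) : comulν Δ i a =
    ∑ k, MinTensor.map (ν i) (ν k) (Δ a) * (x A i k ⊗ₘ (1 : H)) := rfl

theorem commute_comulν (k i : Fin n) (a : A) :
    Commute (comulν Δ k a) (∑ r, x A k r ⊗ₘ x A r i) := by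
  rw [comulν_apply]
  refine commute_block (fun l => MinTensor.map (ν k) (ν l) (Δ a)) (fun l => x A k l ⊗ₘ (1 : H))
    (fun r => x A k r ⊗ₘ x A r i) (fun l r => ?_) (fun r l => ?_)
    (fun l => commute_map_ν' k l (Δ a) l) (fun l => commute_map_ν k l (Δ a) l i)
  · rw [MinTensor.tmul_mul_tmul, isQuantumAut_x.row_mul, one_mul]
    split_ifs with h
    · rw [h]
    · rw [MinTensor.zero_tmul]
  · rw [MinTensor.tmul_mul_tmul, isQuantumAut_x.row_mul, mul_one]
    by_cases h : r = l
    · rw [if_pos h, if_pos h.symm, h]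
    · rw [if_neg h, if_neg (Ne.symm h), MinTensor.zero_tmul]

/-- The coproduct of the free wreath product, with
`Δ (x i j) = ∑ k, x i k ⊗ x k j` and `Δ (ν i a) = ∑ k, (ν i ⊗ ν k) (Δ a) * (x i k ⊗ 1)`. -/
noncomputable def comul : H →⋆ₐ[ℂ] MinTensor H H :=
  lift (comulν Δ) (fun i j => ∑ k, x A i k ⊗ₘ x A k j) isQuantumAut_x.comul
    (commute_comulν Δ)

theorem comul_x (i j : Fin n) : comul Δ (x A i j) = ∑ k, x A i k ⊗ₘ x A k j := lift_x _ _ _ _ i j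

theorem comul_ν (i : Fin n) (a : A) : comul Δ (ν i a) =
    ∑ k, MinTensor.map (ν i) (ν k) (Δ a) * (x A i k ⊗ₘ (1 : H)) := lift_ν _ _ _ _ i a

/-- The matrix with entries `ν i (u k l) * x i j`. -/
noncomputable def corep {ι : Type*} (u : Matrix ι ι A) : Matrix (Fin n × ι) (Fin n × ι) H :=
  Matrix.of fun p q => ν p.1 (u p.2 q.2) * x A p.1 q.1

variable {Δ}

theorem isUnitaryCorep_x : IsUnitaryCorep (comul Δ) (Matrix.of (x A (n := n))) where
  unitary := isQuantumAut_x.unitary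
  comul := comul_x Δ
  transpose := isQuantumAut_x.transpose

section corep

theorem corep_apply {ι : Type*} (u : Matrix ι ι A) (p q : Fin n × ι) :
    corep (n := n) u p q = ν p.1 (u p.2 q.2) * x A p.1 q.1 := rfl

theorem star_corep {ι : Type*} (u : Matrix ι ι A) :
    star (corep (n := n) u) = (corep (n := n) (u.map star)).transpose := by
  ext p q
  change star (ν q.1 (u q.2 p.2) * x A q.1 p.1) = ν q.1 (star (u q.2 p.2)) * x A q.1 p.1
  rw [star_mul, isQuantumAut_x.star_gen, ← map_star, (commute_ν_x _ _ _).eq]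

theorem comul_corep {ι : Type} [Fintype ι] {u : Matrix ι ι A} (hu : ∀ i j, Δ (u i j) = ∑ k, u i k ⊗ₘ u k j) (p q : Fin n × ι) :
    comul Δ (corep u p q) = ∑ r, corep u p r ⊗ₘ corep u r q := by
  obtain ⟨i, k⟩ := p
  obtain ⟨j, l⟩ := q
  simp only [corep_apply]
  rw [map_mul, comul_ν, comul_x, Finset.sum_mul_sum, Fintype.sum_prod_type]
  refine Finset.sum_congr rfl fun r _ => ?_
  have h1 : ∀ t, MinTensor.map (ν i) (ν r) (Δ (u k l)) * (x A i r ⊗ₘ (1 : H)) *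
      (x A i t ⊗ₘ x A t j) =
      if r = t then MinTensor.map (ν i) (ν r) (Δ (u k l)) * (x A i r ⊗ₘ x A r j) else 0 :=
    fun t => by
      rw [mul_assoc, MinTensor.tmul_mul_tmul, isQuantumAut_x.row_mul, one_mul]
      split_ifs with h
      · rw [h]
      · simp
  simp only [h1, Finset.sum_ite_eq, Finset.mem_univ, if_true]
  rw [hu, map_sum, Finset.sum_mul]
  simp only [MinTensor.map_tmul, MinTensor.tmul_mul_tmul]

variable {ι : Type} [Fintype ι] [DecidableEq ι]

theorem corep_mul_transpose {a b : Matrix ι ι A} (h : a * b.transpose = 1) :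
    corep (n := n) a * (corep (n := n) b).transpose = 1 := by
  ext ⟨i, k⟩ ⟨j, l⟩
  have h3 := congrFun (congrFun h k) l
  rw [Matrix.mul_apply] at h3
  have h1 : ∀ s, ∑ r, ν i (a k s) * x A i r * (ν j (b l s) * x A j r) =
      if i = j then ν (n := n) i (a k s * b l s) else 0 := fun s => by
    have h2 : ∀ r, ν i (a k s) * x A i r * (ν j (b l s) * x A j r) =
        if i = j then ν i (a k s * b l s) * x A i r else 0 := fun r => by
      rw [(commute_ν_x j r _).eq, mul_assoc, ← mul_assoc (x A i r), isQuantumAut_x.col_mul]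
      split_ifs with h
      · subst h
        rw [← (commute_ν_x i r _).eq, ← mul_assoc, ← map_mul]
      · simp
    simp only [h2]
    split_ifs
    · rw [← Finset.mul_sum, isQuantumAut_x.row_sum, mul_one]
    · simp
  rw [Matrix.mul_apply, Fintype.sum_prod_type, Finset.sum_comm]
  refine (Finset.sum_congr rfl fun s _ => h1 s).trans ?_
  by_cases hij : i = j
  · subst hij
    simp only [if_true, ← map_sum]
    refine (congrArg (ν i) h3).trans ?_
    simp only [Matrix.one_apply, Prod.mk.injEq, true_and]
    split_ifs <;> simp
  · simp [hij]

theorem transpose_mul_corep {a b : Matrix ι ι A} (h : a.transpose * b = 1) :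
    (corep (n := n) a).transpose * corep (n := n) b = 1 := by
  ext ⟨i, k⟩ ⟨j, l⟩
  have h3 := congrFun (congrFun h k) l
  rw [Matrix.mul_apply] at h3
  have h1 : ∀ r, ∑ s, ν r (a s k) * x A r i * (ν r (b s l) * x A r j) =
      x A r i * ν (n := n) r ((1 : Matrix ι ι A) k l) * x A r j := fun r => by
    rw [← h3, map_sum, Finset.mul_sum, Finset.sum_mul]
    refine Finset.sum_congr rfl fun s _ => ?_
    change _ = x A r i * ν r (a s k * b s l) * x A r j
    rw [(commute_ν_x r i _).eq, map_mul, mul_assoc, mul_assoc, mul_assoc]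
  rw [Matrix.mul_apply, Fintype.sum_prod_type]
  refine (Finset.sum_congr rfl fun r _ => h1 r).trans ?_
  simp only [Matrix.one_apply, Prod.mk.injEq]
  by_cases hkl : k = l
  · simp only [hkl, if_true, and_true, map_one, mul_one, isQuantumAut_x.row_mul]
    split_ifs with h
    · exact isQuantumAut_x.col_sum i
    · simp
  · simp [hkl]

theorem isUnitaryCorep_corep {u : Matrix ι ι A} (hu : IsUnitaryCorep Δ u) :
    IsUnitaryCorep (comul Δ) (corep (n := n) u) where
  unitary := by
    obtain ⟨h1, h2⟩ := Unitary.mem_iff.1 hu.unitary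
    rw [Unitary.mem_iff, star_corep]
    exact ⟨transpose_mul_corep h1, corep_mul_transpose h2⟩
  comul := comul_corep hu.comul
  transpose := by
    obtain ⟨⟨_, w, h1, h2⟩, rfl⟩ := hu.transpose
    exact ⟨⟨_, corep w, transpose_mul_corep h1, corep_mul_transpose h2⟩, rfl⟩

end corep

end WreathAlgebra

end Wreath

/-- The free wreath product of a Woronowicz algebra by the quantum permutation group on `n`
letters. -/
noncomputable def freeWreath (A : WoronowiczAlgebra.{u}) (n : ℕ) : WoronowiczAlgebra.{u} where
  carrier := WreathAlgebra A n
  comul := WreathAlgebra.comul A.comul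
  exists_family := exists_family_of_dense <| by
    let T := (Algebra.adjoin ℂ (corepCoefficients
      (WreathAlgebra.comul (n := n) A.comul))).topologicalClosure
    have hT : IsClosed (T : Set (WreathAlgebra A n)) := Subalgebra.isClosed_topologicalClosure _
    have hsub : ∀ a ∈ corepCoefficients (WreathAlgebra.comul (n := n) A.comul), a ∈ T :=
      fun a ha => Subalgebra.le_topologicalClosure _ (Algebra.subset_adjoin ha)
    have hx : ∀ k l, WreathAlgebra.x A.carrier k l ∈ T := fun k l =>
      hsub _ (WreathAlgebra.isUnitaryCorep_x.mem_coefficients k l)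
    obtain ⟨Λ, d, u, hu, hd⟩ := A.exists_family
    have hu' : ∀ (k : Fin n) l i j, WreathAlgebra.ν k (u l i j) ∈ T := fun k l i j => by
      rw [← mul_one (WreathAlgebra.ν k (u l i j)),
        ← WreathAlgebra.isQuantumAut_x.row_sum k, Finset.mul_sum]
      exact T.sum_mem fun r _ => hsub _
        ((WreathAlgebra.isUnitaryCorep_corep (hu l)).mem_coefficients (k, i) (r, j))
    have hν : ∀ (k : Fin n) (a : A), WreathAlgebra.ν k a ∈ T := fun k a => by
      refine hd.induction (P := fun a => WreathAlgebra.ν k a ∈ T) (fun b hb => ?_)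
        (hT.preimage (continuous_starAlgHom (WreathAlgebra.ν k))) a
      have : Algebra.adjoin ℂ {a | ∃ l i j, u l i j = a} ≤
          T.comap (WreathAlgebra.ν (A := A.carrier) k).toAlgHom := by
        rw [Algebra.adjoin_le_iff]
        rintro _ ⟨l, i, j, rfl⟩
        exact hu' k l i j
      exact this hb
    intro a
    exact WreathAlgebra.mem_of_gen T hT hν hx a

/-! ### Connected graphs and disjoint unions of copies -/

/-- A finite graph (with edges `E ⊆ V × V`) is connected if it has a vertex and any two vertices are
joined by a path of edges, regardless of their direction. -/
def Digraph.IsConnected {V : Type u} (G : Digraph V) : Prop :=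
  Nonempty V ∧ ∀ i j, Relation.EqvGen G.Adj i j

/-- The disjoint union of `n` copies of `G`; the vertex `i` of the `k`-th copy is `(k, i)`. -/
def Digraph.copies {V : Type u} (G : Digraph V) (n : ℕ) : Digraph (Fin n × V) where
  Adj p q := p.1 = q.1 ∧ G.Adj p.2 q.2

/-! The matrix with entries `ν k (u i j) * x k l` satisfies the relations of the disjoint union:
since `ν k (u i j)` commutes with `x k l`, every product of two entries in the same row or column of
blocks separates into a product of `u`'s and a product of `x`'s, and each relation reduces to the
one for `u` together with the orthogonality and partition relations for `x` (`IsQuantumAut.copies`).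
This gives `Φ`. The content of the theorem is the inverse: both kinds of generators have to be
recovered from the generating matrix `X` of the disjoint union.

The element that must correspond to `x k l` is the partial row sum p_kl = ∑ b, X (k,i) (l,b), and
the point is that it does not depend on the vertex i. If (s,t) is an edge, X (k,s) (l,a) * X (k,t)
(l',b) = 0 for l ≠ l', because no edge joins different copies. Hence the partitions of unity formed
at s and at t are orthogonal off the diagonal, which forces them to be equal; connectedness does the
rest (`block_row_sum_eq`). The same holds for column sums, and summing a whole block by rows and by
columns gives |V| times each, so the two agree (`block_row_sum_eq_col_sum`). The row description
makes the rows of (p_kl) partitions of unity, the column description its columns: p is a magic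
unitary.

Every entry of the block (k,l) is absorbed by p_kl on both sides, so entries of different blocks in
one row of blocks are orthogonal (`mul_eq_zero_of_block_ne`). The sums ∑ l, X (k,i) (l,j) therefore
multiply block by block and inherit the relations of G (`sum_block`); they correspond to `ν k (u i
j)`. Multiplying such a sum by p_kl, in either order, isolates X (k,i) (l,j). This one fact yields
both the commutation relation of the free wreath product and one of the two inverse identities; the
other follows from row sums being 1. Compatibility with the coproducts is checked on generators,
where (x_kr ⊗ 1)(x_kt ⊗ x_tl) vanishes unless r = t. -/

section CopiesRelations

variable {V : Type u} [Fintype V] {G : Digraph V} {n : ℕ}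

/-! ### Block products satisfy the relations of the disjoint union -/

theorem Digraph.sum_edges_copies {M : Type*} [AddCommMonoid M]
    (f : (Fin n × V) × (Fin n × V) → M) :
    ∑ e ∈ (G.copies n).edges, f e = ∑ k, ∑ e ∈ G.edges, f ((k, e.1), (k, e.2)) := by
  rw [← Finset.sum_product']
  symm
  refine Finset.sum_bij' (fun p _ => ((p.1, p.2.1), (p.1, p.2.2)))
    (fun e _ => (e.1.1, (e.1.2, e.2.2))) ?_ ?_ ?_ ?_ ?_
  · rintro ⟨k, e⟩ h
    simpa [Digraph.mem_edges, Digraph.copies] using h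
  · rintro ⟨⟨k, i⟩, ⟨l, j⟩⟩ h
    simp only [Digraph.mem_edges, Digraph.copies, Finset.mem_product, Finset.mem_univ,
      true_and] at h ⊢
    exact h.2
  · intros; rfl
  · rintro ⟨⟨k, i⟩, ⟨l, j⟩⟩ h
    simp only [Digraph.mem_edges, Digraph.copies] at h
    obtain ⟨rfl, -⟩ := h
    rfl
  · intros; rfl

namespace IsQuantumAut

variable {B : Type v} [Ring B] [StarRing B]

section

variable {x : V → V → B} (hx : IsQuantumAut G x)
include hx

theorem mul_self (i j : V) : x i j * x i j = x i j := by rw [hx.row_mul, if_pos rfl]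

theorem row_mul_of_ne (i : V) {j k : V} (h : j ≠ k) : x i j * x i k = 0 := by
  rw [hx.row_mul, if_neg h]

theorem col_mul_of_ne (i : V) {j k : V} (h : j ≠ k) : x j i * x k i = 0 := by
  rw [hx.col_mul, if_neg h]

end

/-- Block matrices with blocks `y k l • v k`, where the entries of `v k` commute with the `k`-th row
of the magic unitary `y`, satisfy the relations of the disjoint union of copies. -/
theorem copies {v : Fin n → V → V → B} {y : Fin n → Fin n → B}
    (hv : ∀ k, IsQuantumAut G (v k)) (hy : IsQuantumAut (⊥ : Digraph (Fin n)) y)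
    (hc : ∀ k l i j, Commute (v k i j) (y k l)) :
    IsQuantumAut (G.copies n) fun p q => v p.1 p.2 q.2 * y p.1 q.1 := by
  -- Within one row k of blocks the entries of `v k` commute past `y k l`, so the two kinds of
  -- factors separate. All relations below use only this and its degenerate cases.
  have hrow : ∀ k l l' i j i' j', v k i j * y k l * (v k i' j' * y k l') =
      v k i j * v k i' j' * (y k l * y k l') := fun k l l' i j i' j' => by
    rw [mul_assoc, ← mul_assoc (y k l), ← (hc k l i' j').eq]
    simp only [mul_assoc]
  have hrow1 : ∀ k l i j i' j', v k i j * y k l * (v k i' j' * y k l) =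
      v k i j * v k i' j' * y k l := fun k l i j i' j' => by
    rw [hrow, hy.mul_self]
  have hrow0 : ∀ k l l' i j i' j', l ≠ l' → v k i j * y k l * (v k i' j' * y k l') = 0 :=
    fun k l l' i j i' j' h => by
      rw [hrow, hy.row_mul_of_ne k h, mul_zero]
  -- Nothing is known about commutation between `v k'` and `y k l` for k ≠ k'. The factor `y k' l`
  -- is instead moved to the left of its own `v k'`, next to `y k l`, which it annihilates.
  have hcol0 : ∀ k k' l i j i' j', k ≠ k' → v k i j * y k l * (v k' i' j' * y k' l) = 0 :=
    fun k k' l i j i' j' h => by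
      rw [(hc k' l i' j').eq, mul_assoc, ← mul_assoc (y k l), hy.col_mul_of_ne l h, zero_mul,
        mul_zero]
  constructor
  · rintro ⟨k, i⟩ ⟨l, j⟩
    rw [star_mul, (hv k).star_gen, hy.star_gen, (hc k l i j).eq]
  · rintro ⟨k, i⟩ ⟨l, j⟩ ⟨l', j'⟩
    dsimp only
    by_cases hl : l = l'
    · subst hl
      rw [hrow1, (hv k).row_mul]
      by_cases hj : j = j'
      · rw [if_pos hj, if_pos (by rw [hj])]
      · rw [if_neg hj, if_neg (by simp [hj]), zero_mul]
    · rw [hrow0 _ _ _ _ _ _ _ hl, if_neg (by simp [hl])]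
  · rintro ⟨l, j⟩ ⟨k, i⟩ ⟨k', i'⟩
    dsimp only
    by_cases hk : k = k'
    · subst hk
      rw [hrow1, (hv k).col_mul]
      by_cases hi : i = i'
      · rw [if_pos hi, if_pos (by rw [hi])]
      · rw [if_neg hi, if_neg (by simp [hi]), zero_mul]
    · rw [hcol0 _ _ _ _ _ _ _ hk, if_neg (by simp [hk])]
  · rintro ⟨k, i⟩
    rw [Fintype.sum_prod_type]
    simp only [← Finset.sum_mul, (hv k).row_sum, one_mul, hy.row_sum]
  · rintro ⟨l, j⟩
    rw [Fintype.sum_prod_type]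
    simp only [← Finset.sum_mul, (hv _).col_sum, one_mul, hy.col_sum]
  -- A pair of vertices of the union can fail to be an edge in two ways: the copies differ, and
  -- orthogonality in `y` gives zero; or they agree and the pair is no edge of G, and the relation
  -- for `v k` applies.
  · rintro ⟨k, s⟩ ⟨_, t⟩ ⟨l, i⟩ ⟨l', j⟩ ⟨rfl, hst⟩ h
    dsimp only at hst ⊢
    by_cases hl : l = l'
    · subst hl
      rw [hrow1, (hv k).edge_row hst fun hij => h ⟨rfl, hij⟩, zero_mul]
    · exact hrow0 _ _ _ _ _ _ _ hl
  · rintro ⟨k, s⟩ ⟨_, t⟩ ⟨l, i⟩ ⟨l', j⟩ ⟨rfl, hst⟩ h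
    dsimp only at hst ⊢
    by_cases hl : l = l'
    · subst hl
      rw [hrow1, (hv k).edge_row' hst fun hij => h ⟨rfl, hij⟩, zero_mul]
    · exact hrow0 _ _ _ _ _ _ _ (Ne.symm hl)
  · rintro ⟨l, s⟩ ⟨_, t⟩ ⟨k, i⟩ ⟨k', j⟩ ⟨rfl, hst⟩ h
    dsimp only at hst ⊢
    by_cases hk : k = k'
    · subst hk
      rw [hrow1, (hv k).edge_col hst fun hij => h ⟨rfl, hij⟩, zero_mul]
    · exact hcol0 _ _ _ _ _ _ _ hk
  · rintro ⟨l, s⟩ ⟨_, t⟩ ⟨k, i⟩ ⟨k', j⟩ ⟨rfl, hst⟩ h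
    dsimp only at hst ⊢
    by_cases hk : k = k'
    · subst hk
      rw [hrow1, (hv k).edge_col' hst fun hij => h ⟨rfl, hij⟩, zero_mul]
    · exact hcol0 _ _ _ _ _ _ _ (Ne.symm hk)
  · rintro ⟨k, s⟩ ⟨_, t⟩ ⟨l, i⟩ ⟨_, j⟩ ⟨rfl, hst⟩ ⟨rfl, hij⟩
    dsimp only at hst hij ⊢
    rw [hrow1, hrow1, (hv k).edge_comm hst hij]
  -- Edges of the union stay inside one copy, so the sum over edges in copy k contributes exactly `y
  -- k l`, and these add up to 1.
  · rintro ⟨l, s⟩ ⟨_, t⟩ ⟨rfl, hst⟩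
    rw [Digraph.sum_edges_copies]
    simp only [hrow1, ← Finset.sum_mul, (hv _).edge_sum hst, one_mul, hy.col_sum]
  · rintro ⟨k, s⟩ ⟨_, t⟩ ⟨rfl, hst⟩
    rw [Digraph.sum_edges_copies]
    simp only [hrow1, ← Finset.sum_mul, (hv _).edge_sum' hst, one_mul, hy.row_sum]

/-! ### Block structure of a magic unitary of the disjoint union -/

section Blocks

variable {X : Fin n × V → Fin n × V → B} (hX : IsQuantumAut (G.copies n) X)
include hX

/-- Row sums of a block agree for vertices joined by a path. -/
theorem block_row_sum_eq (k l : Fin n) {s t : V} (h : Relation.EqvGen G.Adj s t) :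
    ∑ j, X (k, s) (l, j) = ∑ j, X (k, t) (l, j) := by
  induction h with
  | rel s t h =>
    -- Two families P_l (at s) and Q_l (at t), each with sum 1, such that P_l Q_l' = 0 for l ≠ l',
    -- coincide: P_l = P_l Q_l = Q_l. The orthogonality is the edge relation for the edge (s,t) of
    -- copy k, since vertices of different copies are never adjacent.
    have h0 : ∀ l l', l ≠ l' →
        (∑ j, X (k, s) (l, j)) * (∑ j, X (k, t) (l', j)) = 0 := fun l l' hl => by
      rw [Finset.sum_mul_sum]
      exact Finset.sum_eq_zero fun i _ => Finset.sum_eq_zero fun j _ =>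
        hX.edge_row ⟨rfl, h⟩ fun h' => hl h'.1
    have h1 : ∀ s, ∑ l, ∑ j, X (k, s) (l, j) = 1 := fun s => by
      rw [← Fintype.sum_prod_type', ← hX.row_sum (k, s)]
    calc _ = (∑ j, X (k, s) (l, j)) * ∑ l', ∑ j, X (k, t) (l', j) := by rw [h1, mul_one]
      _ = (∑ j, X (k, s) (l, j)) * ∑ j, X (k, t) (l, j) := by
        rw [Finset.mul_sum]
        exact Finset.sum_eq_single l (fun l' _ h' => h0 l l' h'.symm) (by simp)
      _ = (∑ l', ∑ j, X (k, s) (l', j)) * ∑ j, X (k, t) (l, j) := by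
        refine ((Finset.sum_mul _ _ _).trans (Finset.sum_eq_single l (fun l' _ h' => h0 l' l h')
          fun h => (h (Finset.mem_univ l)).elim)).symm
      _ = _ := by rw [h1, one_mul]
  | refl => rfl
  | symm _ _ _ ih => exact ih.symm
  | trans _ _ _ _ _ ih ih' => exact ih.trans ih'

/-- Column sums of a block agree for vertices joined by a path. -/
theorem block_col_sum_eq (k l : Fin n) {s t : V} (h : Relation.EqvGen G.Adj s t) :
    ∑ i, X (k, i) (l, s) = ∑ i, X (k, i) (l, t) := by
  induction h with
  | rel s t h =>
    -- The same comparison of two partitions of unity, now indexed by the row copy and with the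
    -- column form of the edge relation.
    have h0 : ∀ k k', k ≠ k' →
        (∑ i, X (k, i) (l, s)) * (∑ i, X (k', i) (l, t)) = 0 := fun k k' hk => by
      rw [Finset.sum_mul_sum]
      exact Finset.sum_eq_zero fun i _ => Finset.sum_eq_zero fun j _ =>
        hX.edge_col ⟨rfl, h⟩ fun h' => hk h'.1
    have h1 : ∀ s, ∑ k, ∑ i, X (k, i) (l, s) = 1 := fun s => by
      rw [← Fintype.sum_prod_type' (f := fun k i => X (k, i) (l, s)), ← hX.col_sum (l, s)]
    calc _ = (∑ i, X (k, i) (l, s)) * ∑ k', ∑ i, X (k', i) (l, t) := by rw [h1, mul_one]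
      _ = (∑ i, X (k, i) (l, s)) * ∑ i, X (k, i) (l, t) := by
        rw [Finset.mul_sum]
        exact Finset.sum_eq_single k (fun k' _ h' => h0 k k' h'.symm) (by simp)
      _ = (∑ k', ∑ i, X (k', i) (l, s)) * ∑ i, X (k, i) (l, t) := by
        refine ((Finset.sum_mul _ _ _).trans (Finset.sum_eq_single k (fun k' _ h' => h0 k' k h')
          fun h => (h (Finset.mem_univ k)).elim)).symm
      _ = _ := by rw [h1, one_mul]
  | refl => rfl
  | symm _ _ _ ih => exact ih.symm
  | trans _ _ _ _ _ ih ih' => exact ih.trans ih'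

/-- In a connected graph, row sums and column sums of a block agree. -/
theorem block_row_sum_eq_col_sum [Algebra ℂ B] (hG : G.IsConnected) (k l : Fin n) (i j : V) :
    ∑ b, X (k, i) (l, b) = ∑ a, X (k, a) (l, j) := by
  have := hG.1
  -- Double counting: the sum of all entries of the block is |V| times the common row sum and also
  -- |V| times the common column sum. Nonemptiness of V permits the division.
  have h : (Fintype.card V : ℂ) • ∑ b, X (k, i) (l, b) =
      (Fintype.card V : ℂ) • ∑ a, X (k, a) (l, j) :=
    calc _ = ∑ a, ∑ b, X (k, a) (l, b) := by
          rw [Finset.sum_congr rfl fun a _ => hX.block_row_sum_eq k l (hG.2 a i),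
            Finset.sum_const, Finset.card_univ, ← Nat.cast_smul_eq_nsmul ℂ]
      _ = ∑ b, ∑ a, X (k, a) (l, b) := Finset.sum_comm
      _ = _ := by
          rw [Finset.sum_congr rfl fun b _ => hX.block_col_sum_eq k l (hG.2 b j),
            Finset.sum_const, Finset.card_univ, ← Nat.cast_smul_eq_nsmul ℂ]
  have h0 : (Fintype.card V : ℂ) ≠ 0 := Nat.cast_ne_zero.2 Fintype.card_ne_zero
  rw [← one_smul ℂ (∑ b, X (k, i) (l, b)), ← inv_mul_cancel₀ h0, mul_smul, h, ← mul_smul,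
    inv_mul_cancel₀ h0, one_smul]

/-- The entries of a row are mutually orthogonal idempotents, so an entry is absorbed by any partial
row sum containing it. With independence of the vertex, this makes the block sum p_kl a unit for
every entry of the block. -/
theorem mul_block_row_sum (k l : Fin n) (i j : V) :
    X (k, i) (l, j) * ∑ b, X (k, i) (l, b) = X (k, i) (l, j) := by
  rw [Finset.mul_sum, Finset.sum_eq_single j
    (fun b _ hb => hX.row_mul_of_ne _ fun h => hb (congrArg Prod.snd h).symm) (by simp)]
  exact hX.mul_self _ _

theorem block_row_sum_mul (k l : Fin n) (i j : V) :
    (∑ b, X (k, i) (l, b)) * X (k, i) (l, j) = X (k, i) (l, j) := by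
  rw [Finset.sum_mul, Finset.sum_eq_single j
    (fun b _ hb => hX.row_mul_of_ne _ fun h => hb (congrArg Prod.snd h)) (by simp)]
  exact hX.mul_self _ _

theorem block_row_sum_mul_row_sum (k l l' : Fin n) (i : V) (h : l ≠ l') :
    (∑ b, X (k, i) (l, b)) * ∑ b, X (k, i) (l', b) = 0 := by
  rw [Finset.sum_mul_sum]
  exact Finset.sum_eq_zero fun _ _ => Finset.sum_eq_zero fun _ _ =>
    hX.row_mul_of_ne _ fun h' => h (congrArg Prod.fst h')

/-- Entries of different blocks in the same row of blocks are orthogonal. -/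
theorem mul_eq_zero_of_block_ne (hG : G.IsConnected) (k : Fin n) {l l' : Fin n} (h : l ≠ l')
    (i j i' j' : V) : X (k, i) (l, j) * X (k, i') (l', j') = 0 := by
  -- The left factor produces p_kl on its right and the right factor p_kl' on its left. Once both
  -- are written at the same vertex i, they are sums over disjoint parts of one row, so their
  -- product is zero.
  rw [← hX.mul_block_row_sum, ← hX.block_row_sum_mul k l' i', mul_assoc,
    ← mul_assoc (∑ b, X (k, i) (l, b)), hX.block_row_sum_eq k l' (hG.2 i' i),
    hX.block_row_sum_mul_row_sum k l l' i h, zero_mul, mul_zero]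

/-- The product of sums of entries along a row of blocks. -/
theorem sum_block_mul_sum_block (hG : G.IsConnected) (k : Fin n) (i j i' j' : V) :
    (∑ l, X (k, i) (l, j)) * ∑ l, X (k, i') (l, j') =
      ∑ l, X (k, i) (l, j) * X (k, i') (l, j') := by
  rw [Finset.sum_mul_sum]
  exact Finset.sum_congr rfl fun l _ => Finset.sum_eq_single l
    (fun l' _ h => hX.mul_eq_zero_of_block_ne hG k h.symm _ _ _ _) (by simp)

/-- The row sums of the blocks form a magic unitary. -/
theorem block_row_sum [Algebra ℂ B] (hG : G.IsConnected) (i : V) :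
    IsQuantumAut (⊥ : Digraph (Fin n)) fun k l => ∑ j, X (k, i) (l, j) where
  star_gen k l := by simp only [star_sum, hX.star_gen]
  row_mul k l l' := by
    split_ifs with h
    · subst h
      rw [Finset.sum_mul]
      exact Finset.sum_congr rfl fun j _ => hX.mul_block_row_sum k l i j
    · exact hX.block_row_sum_mul_row_sum k l l' i h
  col_mul l k k' := by
    split_ifs with h
    · subst h
      rw [Finset.sum_mul]
      exact Finset.sum_congr rfl fun j _ => hX.mul_block_row_sum k l i j
    -- Orthogonality for different k is invisible in the row sums; rewritten as column sums at one
    -- vertex of copy l, they involve disjoint parts of a single column.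
    · rw [hX.block_row_sum_eq_col_sum hG k l i i, hX.block_row_sum_eq_col_sum hG k' l i i,
        Finset.sum_mul_sum]
      exact Finset.sum_eq_zero fun _ _ => Finset.sum_eq_zero fun _ _ =>
        hX.col_mul_of_ne _ fun h' => h (congrArg Prod.fst h')
  row_sum k := by
    rw [← hX.row_sum (k, i), Fintype.sum_prod_type]
  col_sum l := by
    simp only [hX.block_row_sum_eq_col_sum hG _ l i i]
    rw [← hX.col_sum (l, i), Fintype.sum_prod_type]
  edge_row h := h.elim
  edge_row' h := h.elim
  edge_col h := h.elim
  edge_col' h := h.elim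
  edge_comm h := h.elim
  edge_sum h := h.elim
  edge_sum' h := h.elim

/-- The sum of the blocks of a row of blocks satisfies the relations of the graph. -/
theorem sum_block [Algebra ℂ B] (hG : G.IsConnected) (k : Fin n) :
    IsQuantumAut G fun i j => ∑ l, X (k, i) (l, j) where
  star_gen i j := by simp only [star_sum, hX.star_gen]
  row_mul i j j' := by
    rw [hX.sum_block_mul_sum_block hG]
    split_ifs with h
    · subst h
      exact Finset.sum_congr rfl fun l _ => hX.mul_self _ _
    · exact Finset.sum_eq_zero fun l _ => hX.row_mul_of_ne _ fun h' => h (congrArg Prod.snd h')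
  col_mul j i i' := by
    rw [hX.sum_block_mul_sum_block hG]
    split_ifs with h
    · subst h
      exact Finset.sum_congr rfl fun l _ => hX.mul_self _ _
    · exact Finset.sum_eq_zero fun l _ => hX.col_mul_of_ne _ fun h' => h (congrArg Prod.snd h')
  row_sum i := by
    rw [Finset.sum_comm, ← hX.row_sum (k, i), Fintype.sum_prod_type]
  col_sum j := by
    -- With l fixed, summing over i gives the column sum of the block (k,l), that is p_kl, and the
    -- p_kl add up to 1 over l.
    rw [Finset.sum_comm]
    simp only [← hX.block_row_sum_eq_col_sum hG k _ j j]
    exact (hX.block_row_sum hG j).row_sum k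
  edge_row h h' := by
    rw [hX.sum_block_mul_sum_block hG]
    exact Finset.sum_eq_zero fun l _ => hX.edge_row ⟨rfl, h⟩ fun h'' => h' h''.2
  edge_row' h h' := by
    rw [hX.sum_block_mul_sum_block hG]
    exact Finset.sum_eq_zero fun l _ => hX.edge_row' ⟨rfl, h⟩ fun h'' => h' h''.2
  edge_col h h' := by
    rw [hX.sum_block_mul_sum_block hG]
    exact Finset.sum_eq_zero fun l _ => hX.edge_col ⟨rfl, h⟩ fun h'' => h' h''.2
  edge_col' h h' := by
    rw [hX.sum_block_mul_sum_block hG]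
    exact Finset.sum_eq_zero fun l _ => hX.edge_col' ⟨rfl, h⟩ fun h'' => h' h''.2
  edge_comm h h' := by
    rw [hX.sum_block_mul_sum_block hG, hX.sum_block_mul_sum_block hG]
    exact Finset.sum_congr rfl fun l _ => hX.edge_comm ⟨rfl, h⟩ ⟨rfl, h'⟩
  edge_sum {s t} h := by
    simp only [hX.sum_block_mul_sum_block hG]
    -- The goal is split as 1 = ∑ l, p_kl. For fixed l, the relation for the edge from (l,s) to
    -- (l,t) involves the edges of every copy k', whereas only those of copy k are wanted;
    -- multiplying it on the left by p_kl selects them.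
    rw [Finset.sum_comm, ← (hX.block_row_sum hG s).row_sum k]
    refine Finset.sum_congr rfl fun l _ => ?_
    -- An entry of the block (k',l) produces p_k'l on its left, and p_kl p_k'l is p_kl or 0 by
    -- column orthogonality of the magic unitary p.
    have hp : ∀ k' i, (∑ b, X (k, s) (l, b)) * X (k', i) (l, s) =
        if k = k' then X (k', i) (l, s) else 0 := fun k' i => by
      rw [← hX.block_row_sum_mul k' l i s, ← mul_assoc, hX.block_row_sum_eq k' l (hG.2 i s)]
      split_ifs with hk
      · subst hk
        rw [(hX.block_row_sum hG s).mul_self k l]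
      · rw [(hX.block_row_sum hG s).col_mul_of_ne l hk, zero_mul]
    have h1 := hX.edge_sum (s := (l, s)) (t := (l, t)) ⟨rfl, h⟩
    rw [Digraph.sum_edges_copies] at h1
    calc _ = ∑ k', ∑ e ∈ G.edges,
          (if k = k' then X (k', e.1) (l, s) else 0) * X (k', e.2) (l, t) := by
          simp only [ite_mul, zero_mul, Finset.sum_ite_irrel, Finset.sum_const_zero,
            Finset.sum_ite_eq, Finset.mem_univ, if_true]
      _ = (∑ b, X (k, s) (l, b)) * ∑ k', ∑ e ∈ G.edges,
          X (k', e.1) (l, s) * X (k', e.2) (l, t) := by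
          simp only [← hp, Finset.mul_sum, mul_assoc]
      _ = _ := by rw [h1, mul_one]
  edge_sum' {s t} h := by
    simp only [hX.sum_block_mul_sum_block hG]
    -- No truncation is needed here: summing over l already runs through the edges of all copies, so
    -- this is the relation for X itself.
    rw [Finset.sum_comm, ← hX.edge_sum' (s := (k, s)) (t := (k, t)) ⟨rfl, h⟩,
      Digraph.sum_edges_copies]

/-- The block projection p_kl kills the terms with l' ≠ l and fixes the remaining one. This factors
the original entry into the candidates for `ν k (u i j)` and `x k l`; the vertex i' is free because
p_kl does not depend on it. -/
theorem sum_block_mul_block_row_sum (hG : G.IsConnected) (k l : Fin n) (i i' j : V) :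
    (∑ l', X (k, i) (l', j)) * ∑ b, X (k, i') (l, b) = X (k, i) (l, j) := by
  rw [hX.block_row_sum_eq k l (hG.2 i' i), Finset.sum_mul, Finset.sum_eq_single l
    (fun l' _ h => ?_) (by simp), hX.mul_block_row_sum]
  rw [Finset.mul_sum]
  exact Finset.sum_eq_zero fun b _ => hX.mul_eq_zero_of_block_ne hG k h _ _ _ _

theorem block_row_sum_mul_sum_block (hG : G.IsConnected) (k l : Fin n) (i i' j : V) :
    (∑ b, X (k, i') (l, b)) * (∑ l', X (k, i) (l', j)) = X (k, i) (l, j) := by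
  rw [hX.block_row_sum_eq k l (hG.2 i' i), Finset.mul_sum, Finset.sum_eq_single l
    (fun l' _ h => ?_) (by simp), hX.block_row_sum_mul]
  rw [Finset.sum_mul]
  exact Finset.sum_eq_zero fun b _ => hX.mul_eq_zero_of_block_ne hG k h.symm _ _ _ _

end Blocks

end IsQuantumAut

end CopiesRelations

/-! ### Reduction to generators -/

namespace AutAlgebra

variable {V : Type u} [Fintype V] {G : Digraph V}

theorem mem_of_gen {C : Type v} [CStarAlgebra C] (f : AutAlgebra G →⋆ₐ[ℂ] C)
    (T : Subalgebra ℂ C) (hT : IsClosed (T : Set C)) (h : ∀ i j, f (gen G i j) ∈ T)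
    (a : AutAlgebra G) : f a ∈ T :=
  UnivCStar.mem_of_gen _ f T hT (fun ⟨i, j⟩ => ⟨h i j, by
    rw [map_star]
    change f (star (gen G i j)) ∈ T
    rw [(isQuantumAut_gen G).star_gen]
    exact h i j⟩) a

theorem hom_ext {C : Type v} [CStarAlgebra C] {f g : AutAlgebra G →⋆ₐ[ℂ] C}
    (h : ∀ i j, f (gen G i j) = g (gen G i j)) : f = g :=
  UnivCStar.hom_ext _ fun a => congrFun (congrArg DFunLike.coe (FreeStarAlgebra.hom_ext
    (f := f.comp (UnivCStar.of _)) (g := g.comp (UnivCStar.of _)) fun ⟨i, j⟩ => h i j)) a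

/-- The centralizer of `c` is a closed subalgebra, and the generators are self-adjoint, so adjoints
need no separate check. -/
theorem commute_of_gen {C : Type v} [CStarAlgebra C] (f : AutAlgebra G →⋆ₐ[ℂ] C) (c : C)
    (h : ∀ i j, Commute (f (gen G i j)) c) (a : AutAlgebra G) : Commute (f a) c := by
  have := mem_of_gen f (Subalgebra.centralizer ℂ {c}) (Set.isClosed_centralizer _)
    (fun i j => by
      rw [Subalgebra.mem_centralizer_iff]
      rintro _ rfl
      exact (h i j).eq.symm) a
  rw [Subalgebra.mem_centralizer_iff] at this
  exact (this c rfl).symm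

end AutAlgebra

theorem WreathAlgebra.hom_ext {A : Type u} [CStarAlgebra A] {n : ℕ} {C : Type v} [CStarAlgebra C]
    {f g : WreathAlgebra A n →⋆ₐ[ℂ] C} (hν : ∀ k a, f (ν k a) = g (ν k a))
    (hx : ∀ k l, f (x A k l) = g (x A k l)) : f = g :=
  StarAlgHom.ext fun a => mem_of_gen (AlgHom.equalizer f.toAlgHom g.toAlgHom)
    (isClosed_eq (continuous_starAlgHom f) (continuous_starAlgHom g)) hν hx a

/-! ### The two mutually inverse homomorphisms -/

namespace AutAlgebra

variable {V : Type u} [Fintype V] (G : Digraph V) (n : ℕ)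

/-- The homomorphism to the free wreath product with `X (k, i) (l, j) ↦ ν k (u i j) * x k l`. -/
noncomputable def toWreath : AutAlgebra (G.copies n) →⋆ₐ[ℂ] WreathAlgebra (AutAlgebra G) n :=
  lift (fun p q => WreathAlgebra.ν p.1 (gen G p.2 q.2) * WreathAlgebra.x _ p.1 q.1) <|
    IsQuantumAut.copies (v := fun k i j => WreathAlgebra.ν k (gen G i j))
      (fun k => isQuantumAut_of_hom G ((WreathAlgebra.ν k).comp (UnivCStar.of _))
        fun _ _ h => congrArg (WreathAlgebra.ν k) (UnivCStar.of_rel _ h))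
      WreathAlgebra.isQuantumAut_x fun _ _ _ _ => WreathAlgebra.commute_ν_x _ _ _

variable {G n}

theorem toWreath_gen (p q : Fin n × V) : toWreath G n (gen (G.copies n) p q) =
    WreathAlgebra.ν p.1 (gen G p.2 q.2) * WreathAlgebra.x (AutAlgebra G) p.1 q.1 := lift_gen _ _ _ _

/-- In the product of the two coproducts, row orthogonality of `x` in the first tensor leg removes
all terms in which the summation indices of the two factors differ. What remains is the matrix
coproduct, so `toWreath` intertwines the coproducts on generators. -/
theorem comul_ν_mul_x (k l : Fin n) (i j : V) :
    WreathAlgebra.comul (comul G)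
        (WreathAlgebra.ν k (gen G i j) * WreathAlgebra.x (AutAlgebra G) k l) =
      ∑ r : Fin n × V, (WreathAlgebra.ν k (gen G i r.2) * WreathAlgebra.x (AutAlgebra G) k r.1) ⊗ₘ
        (WreathAlgebra.ν r.1 (gen G r.2 j) * WreathAlgebra.x (AutAlgebra G) r.1 l) := by
  rw [map_mul, WreathAlgebra.comul_ν, WreathAlgebra.comul_x, Finset.sum_mul,
    Fintype.sum_prod_type]
  refine Finset.sum_congr rfl fun r _ => ?_
  rw [Finset.mul_sum, Finset.sum_eq_single r (fun t _ h => ?_)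
    fun h => (h (Finset.mem_univ r)).elim]
  · rw [mul_assoc, MinTensor.tmul_mul_tmul, WreathAlgebra.isQuantumAut_x.mul_self, one_mul,
      comul_gen, map_sum, Finset.sum_mul]
    simp only [MinTensor.map_tmul, MinTensor.tmul_mul_tmul]
  · rw [mul_assoc, MinTensor.tmul_mul_tmul, WreathAlgebra.isQuantumAut_x.row_mul_of_ne k h.symm,
      MinTensor.zero_tmul, mul_zero]

theorem comul_toWreath (a : AutAlgebra (G.copies n)) :
    WreathAlgebra.comul (comul G) (toWreath G n a) =
      MinTensor.map (toWreath G n) (toWreath G n) (comul (G.copies n) a) := by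
  refine DFunLike.congr_fun (f := (WreathAlgebra.comul (comul G)).comp (toWreath G n))
    (g := (MinTensor.map (toWreath G n) (toWreath G n)).comp (comul (G.copies n)))
    (hom_ext fun p q => ?_) a
  rw [StarAlgHom.comp_apply, StarAlgHom.comp_apply, toWreath_gen, comul_gen, map_sum,
    comul_ν_mul_x]
  simp only [MinTensor.map_tmul, toWreath_gen]

/-- The homomorphism `u i j ↦ ∑ l, X (k, i) (l, j)`. -/
noncomputable def sumBlock (hG : G.IsConnected) (k : Fin n) :
    AutAlgebra G →⋆ₐ[ℂ] AutAlgebra (G.copies n) :=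
  lift _ ((isQuantumAut_gen (G.copies n)).sum_block hG k)

theorem sumBlock_gen (hG : G.IsConnected) (k : Fin n) (i j : V) :
    sumBlock hG k (gen G i j) = ∑ l, gen (G.copies n) (k, i) (l, j) := lift_gen _ _ _ _

/-- On generators both orders of the product equal the single entry X (k,i) (l,j). -/
theorem commute_sumBlock (hG : G.IsConnected) (i₀ : V) (k l : Fin n) (a : AutAlgebra G) :
    Commute (sumBlock hG k a) (∑ j, gen (G.copies n) (k, i₀) (l, j)) :=
  commute_of_gen _ _ (fun i j => by
    rw [sumBlock_gen]
    exact ((isQuantumAut_gen (G.copies n)).sum_block_mul_block_row_sum hG k l i i₀ j).trans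
      ((isQuantumAut_gen (G.copies n)).block_row_sum_mul_sum_block hG k l i i₀ j).symm) a

/-- The homomorphism from the free wreath product with `ν k (u i j) ↦ ∑ l, X (k, i) (l, j)` and
`x k l ↦ ∑ j, X (k, i₀) (l, j)`, for a base vertex `i₀`. -/
noncomputable def ofWreath (hG : G.IsConnected) (i₀ : V) :
    WreathAlgebra (AutAlgebra G) n →⋆ₐ[ℂ] AutAlgebra (G.copies n) :=
  WreathAlgebra.lift (sumBlock hG) (fun k l => ∑ j, gen (G.copies n) (k, i₀) (l, j))
    ((isQuantumAut_gen (G.copies n)).block_row_sum hG i₀) (commute_sumBlock hG i₀)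

theorem ofWreath_ν (hG : G.IsConnected) (i₀ : V) (k : Fin n) (i j : V) :
    ofWreath hG i₀ (WreathAlgebra.ν k (gen G i j)) = ∑ l, gen (G.copies n) (k, i) (l, j) :=
  (WreathAlgebra.lift_ν _ _ _ _ _ _).trans (sumBlock_gen _ _ _ _)

theorem ofWreath_x (hG : G.IsConnected) (i₀ : V) (k l : Fin n) :
    ofWreath hG i₀ (WreathAlgebra.x (AutAlgebra G) k l) = ∑ j, gen (G.copies n) (k, i₀) (l, j) :=
  WreathAlgebra.lift_x _ _ _ _ _ _

theorem ofWreath_comp_toWreath (hG : G.IsConnected) (i₀ : V) :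
    (ofWreath hG i₀).comp (toWreath G n) = StarAlgHom.id ℂ (AutAlgebra (G.copies n)) :=
  hom_ext fun ⟨k, i⟩ ⟨l, j⟩ => by
    rw [StarAlgHom.comp_apply, toWreath_gen, map_mul, ofWreath_ν,
      ofWreath_x]
    exact (isQuantumAut_gen (G.copies n)).sum_block_mul_block_row_sum hG k l i i₀ j

/-- Summing `ν k (u i j) * x k l` over l removes the factor `x`, and summing it over j, with i = i₀,
removes the factor `ν k (u i₀ j)`, because rows of both magic unitaries add up to 1. -/
theorem toWreath_comp_ofWreath (hG : G.IsConnected) (i₀ : V) :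
    (toWreath G n).comp (ofWreath hG i₀) = StarAlgHom.id ℂ (WreathAlgebra (AutAlgebra G) n) := by
  refine WreathAlgebra.hom_ext (fun k a => ?_) fun k l => ?_
  · refine DFunLike.congr_fun
      (f := ((toWreath G n).comp (ofWreath hG i₀)).comp (WreathAlgebra.ν k))
      (g := WreathAlgebra.ν k) (hom_ext fun i j => ?_) a
    rw [StarAlgHom.comp_apply, StarAlgHom.comp_apply, ofWreath_ν, map_sum]
    simp only [toWreath_gen]
    rw [← Finset.mul_sum, WreathAlgebra.isQuantumAut_x.row_sum, mul_one]
  · rw [StarAlgHom.comp_apply, ofWreath_x, map_sum]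
    simp only [toWreath_gen]
    rw [← Finset.sum_mul, ← map_sum, (isQuantumAut_gen G).row_sum, map_one, one_mul]
    rfl

end AutAlgebra

theorem theorem4p2 {V : Type u} [Fintype V] (G : Digraph V) (hG : G.IsConnected)
    (n : ℕ) (hn : 1 ≤ n) :
    ∃ Φ : WoronowiczAlgebra.Iso (quantumAut (G.copies n)) (freeWreath (quantumAut G) n),
      ∀ (k l : Fin n) (i j : V),
        Φ.toStarAlgEquiv (AutAlgebra.gen (G.copies n) (k, i) (l, j)) =
          WreathAlgebra.ν k (AutAlgebra.gen G i j) * WreathAlgebra.x (AutAlgebra G) k l := by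
  -- A base vertex is needed to write the preimage of `x k l` as a row sum; its choice is
  -- immaterial. For empty V the domain would be ℂ, while the free wreath product would still
  -- contain the quantum permutation group.
  obtain ⟨i₀⟩ := hG.1
  exact ⟨{ StarAlgEquiv.ofStarAlgHom (AutAlgebra.toWreath G n) (AutAlgebra.ofWreath hG i₀)
      (AutAlgebra.ofWreath_comp_toWreath hG i₀) (AutAlgebra.toWreath_comp_ofWreath hG i₀) with
      map_comul := AutAlgebra.comul_toWreath },
    fun k l i j => AutAlgebra.toWreath_gen (k, i) (l, j)⟩
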